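/- Let $(\mathcal X,\rho)$ be a metric space with $\rho\le 1$. For a distribution $P$ on $\mathcal X$ and a finite non-empty multiset $T$ of points, let $R(P,T)=\mathbb E_{X\sim P}[\min_{t\in T}\rho(X,t)]$, and for a finite sample $S$ let $R(S,T)$ be the risk of $T$ on the uniform distribution over $S$ (with multiplicities). Let $\mathrm{OPT}$ be a minimizer of $R(P,T)$ over $T\in\mathcal X^k$, assumed to exist. Algorithm SKM2 gets $k,m\in\mathbb N$ with $k\ge 1$, $\delta\in(0,1)$, and an i.i.d. sequence $x_1,\dots,x_m\sim P$. Put $q=(32k^2\log(8m)+32k\log(8/\delta))/m$ and $\beta_m=1/\sqrt m$. From the first half of the sequence, the first $m/4$ points form $S_0$ and the others are split equally into consecutive sub-samples $S_1,\dots,S_k$ (sizes rounded down: $|S_0|=\lfloor m/4\rfloor$, and $|S_i|=\lfloor(\lfloor m/2\rfloor-\lfloor m/4\rfloor)/k\rfloor$ for $1\le i\le k$). A multiset $Z$ of $k$ points is $(r,q)$-good if $R(S_0,Z)\le r$. A multiset $Z$ of $j<k$ points is $(r,q)$-good if $\mathbb P_{X\sim S_{j+1}}[Z\cup\{X\}\text{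 is }(r,q)\text{-good}]\ge 2q$, where $X$ is uniform over $S_{j+1}$. Let $r$ be the smallest number of the form $\beta_m(1+\beta_m)^n$, $n\in\{0,1,2,\dots\}$, for which $\emptyset$ is $(r,q)$-good. Starting with $T_{\mathrm{out}}=\emptyset$, the algorithm observes the points $x_j$, $j=\lfloor m/2\rfloor+1,\dots,m$, in order, and adds $x_j$ to $T_{\mathrm{out}}$ when it is observed if and only if $|T_{\mathrm{out}}|<k$ and $T_{\mathrm{out}}\cup\{x_j\}$ is $(r,q)$-good (unions are unions of multisets). **Theorem.** There is a universal constant $C>0$ such that the following holds for every such $(\mathcal X,\rho)$, every $k\ge 1$, every $\delta\in(0,1)$, every distribution $P$ on $\mathcal X$, and every $m\ge 2$ that is large enough in the sense that $m\ge C\,(k^3\log m+k^2\log(1/\delta))$ (for smaller $m$ the first bound below exceeds $1$ and says nothing, as $\rho\le 1$). 1. For every $\gamma\in(0,\tfrac12)$, with probability at least $1-\delta$, SKM2 selects exactly $k$ centers and $$R(P,T_{\mathrm{out}})\le(2+2\gamma)R(P,\mathrm{OPT})+\frac1\gamma\cdot C\,\frac{k^3\log m+k^2\log(1/\delta)}{m}+C\sqrt{\frac{k\log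 m+\log(1/\delta)}{m}}.$$ 2. With probability at least $1-\delta$, SKM2 selects exactly $k$ centers and $$R(P,T_{\mathrm{out}})\le 2R(P,\mathrm{OPT})+C\sqrt{\frac{k^3\log m+k^2\log(1/\delta)}{m}}.$$ -/

import Mathlib

open MeasureTheory

namespace NoSubstitution

noncomputable section

variable {X : Type*} [MetricSpace X]

/-- The `k`-median risk `R(P, T) = E_{x ∼ P} [min_{t ∈ T} ρ(x, t)]` of a (finite, non-empty)
set of centers `T` on the distribution `P`. -/
def risk [MeasurableSpace X] (P : Measure X) (T : Set X) : ℝ :=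
  ∫ x, Metric.infDist x T ∂P

/-- `OPT` minimizes the risk on `P` among all `k`-tuples of centers from the whole space. -/
def IsOptimal [MeasurableSpace X] (P : Measure X) {k : ℕ} (OPT : Fin k → X) : Prop :=
  ∀ T : Fin k → X, risk P (Set.range OPT) ≤ risk P (Set.range T)

/-- The risk `R(S_I, T)` of `T` on the uniform distribution over the sub-sample `(S i)_{i ∈ I}`
(repeated sample points are counted with multiplicity). -/
def empRisk {m : ℕ} (S : Fin m → X) (I : Finset (Fin m)) (T : Set X) : ℝ :=
  (∑ i ∈ I, Metric.infDist (S i) T) / (I.card : ℝ)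

/-- Times of the sub-sample `S₀`: the first `⌊m/4⌋` time steps (time steps start at `0`). -/
def firstBlock (m : ℕ) : Finset (Fin m) :=
  Finset.univ.filter fun i => (i : ℕ) < m / 4

/-- The common size of the sub-samples `S₁, …, S_k`, which split the remainder of the first half
of the sequence equally (a remainder of fewer than `k` elements is not used). -/
def blockSize (k m : ℕ) : ℕ := (m / 2 - m / 4) / k

/-- Times of the sub-sample `S_{j+1}`, for `j = 0, …, k - 1`. -/
def block (k m j : ℕ) : Finset (Fin m) :=
  Finset.univ.filter fun i =>
    m / 4 + j * blockSize k m ≤ (i : ℕ) ∧ (i : ℕ) < m / 4 + (j + 1) * blockSize k m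

open scoped Classical in
/-- Goodness of a multiset `Z` to which `n` further centers have to be added, so that
`|Z| = k - n`. For `n = 0` the risk on `S₀` must be at most `r`; otherwise, with `j = |Z|`,
at least a `2q` fraction of the points `x` of `S_{j+1}` must make `Z ∪ {x}` good. -/
def GoodAux (k : ℕ) {m : ℕ} (S : Fin m → X) (r q : ℝ) : ℕ → Multiset X → Prop
  | 0, Z => empRisk S (firstBlock m) {z | z ∈ Z} ≤ r
  | n + 1, Z =>
      2 * q ≤ (((block k m (k - (n + 1))).filter fun i => GoodAux k S r q n (S i ::ₘ Z)).card : ℝ)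
        / ((block k m (k - (n + 1))).card : ℝ)

/-- The predicate "`Z` is `(r, q)`-good", for multisets `Z` of size at most `k`. -/
def Good (k : ℕ) {m : ℕ} (S : Fin m → X) (r q : ℝ) (Z : Multiset X) : Prop :=
  Z.card ≤ k ∧ GoodAux k S r q (k - Z.card) Z

/-- The parameter `q` of the algorithm. -/
def qParam (k m : ℕ) (δ : ℝ) : ℝ :=
  (32 * (k : ℝ) ^ 2 * Real.log (8 * m) + 32 * (k : ℝ) * Real.log (8 / δ)) / (m : ℝ)

/-- The candidate thresholds `β_m (1 + β_m)^n` with `β_m = 1 / √m`, increasing in `n`. -/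
def threshold (m n : ℕ) : ℝ :=
  1 / Real.sqrt m * (1 + 1 / Real.sqrt m) ^ n

/-- The threshold `r` chosen by the algorithm: the smallest candidate for which `∅` is good. -/
def chosenThreshold (k : ℕ) {m : ℕ} (δ : ℝ) (S : Fin m → X) : ℝ :=
  threshold m (sInf {n : ℕ | Good k S (threshold m n) (qParam k m δ) 0})

open scoped Classical in
/-- One step of the selection phase: `T` is the current collection of centers, and the point `x`
observed now is either added to it or discarded for good. -/
def step (k : ℕ) {m : ℕ} (δ : ℝ) (S : Fin m → X) (T : Multiset X) (x : X) : Multiset X :=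
  if T.card < k ∧ Good k S (chosenThreshold k δ S) (qParam k m δ) (x ::ₘ T) then x ::ₘ T else T

/-- The output `T_out` of SKM2 with inputs `k`, `m`, `δ` on the sequence `S`: starting from the
empty collection, the selection step is performed in order at the time steps of the second half
of the sequence. Only `S₀, …, S_k`, which lie in the first half, enter the notion of goodness. -/
def skm2 (k m : ℕ) (δ : ℝ) (S : Fin m → X) : Multiset X :=
  ((List.finRange m).filter fun i : Fin m => m / 2 ≤ (i : ℕ)).foldl (fun T i => step k δ S T (S i)) 0

end

end NoSubstitution

/-! The empty collection is good at a small threshold. Around each fixed center `c j` take a ball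
whose radius `s j` is the `4q`-quantile of the distance to `c j`. By Chernoff, at least a `2q`
fraction of each sub-sample falls in its ball. Any choice of one point per ball has risk at most `2
R(P, c) + 4kq` (`risk_le_two_mul_risk_add`): a point outside the open ball of its nearest center is
at distance at least `s j` from that center, so moving the center at most doubles its cost, and the
open balls have mass at most `4q` each. Hoeffding on `S₀` transfers this to the empirical risk with
error `ε`, and `good_zero_of_frequent` unrolls the recursion. Hence the chosen threshold is at most
`max β ((1 + β) R)` with `R = 2 R(P, c) + 4kq + ε`.

Conversely, goodness is kept during the selection. If the current `j < k` centers are good, a `2q`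
fraction of `S_{j+1}` extends them, so by Chernoff the extending points have true mass at least `q`,
and a window of about `m / (2k)` later points contains one of them. The `k` windows thus produce `k`
centers (`card_skm2`). Their empirical risk is at most the threshold, and Hoeffding bounds their
true risk.

The selected centers and the threshold are random, so all deviations are bounded for fixed time
indices and a fixed threshold exponent, followed by a union bound over about `m ^ k` choices. For
fixed indices, the extending set ignores the coordinates being tested (`extensions_piecewise`), so
resampling those coordinates reduces each bound to a deterministic set or function. -/

namespace NoSubstitution

open ProbabilityTheory

/-! ### Concentration for product measures -/

section Concentration

variable {X : Type*} [MeasurableSpace X] {m : ℕ} (P : Measure X) [IsProbabilityMeasure P]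

/-- Resampling the coordinates in `I` independently preserves the product distribution. -/
lemma measurePreserving_piecewise (I : Finset (Fin m)) :
    MeasurePreserving (fun p : (Fin m → X) × (Fin m → X) => I.piecewise p.1 p.2)
      ((Measure.pi fun _ => P).prod (Measure.pi fun _ => P)) (Measure.pi fun _ => P) := by
  have hm : Measurable (fun p : (Fin m → X) × (Fin m → X) => I.piecewise p.1 p.2) := by
    refine measurable_pi_lambda _ fun i => ?_
    by_cases hi : i ∈ I
    · simp only [Finset.piecewise, hi, if_true]
      fun_prop
    · simp only [Finset.piecewise, hi, if_false]
      fun_prop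
  refine ⟨hm, (Measure.pi_eq fun s hs => ?_).symm⟩
  rw [Measure.map_apply hm (MeasurableSet.univ_pi hs)]
  have : (fun p : (Fin m → X) × (Fin m → X) => I.piecewise p.1 p.2) ⁻¹' (Set.univ.pi s)
      = (Set.univ.pi fun i => if i ∈ I then s i else Set.univ) ×ˢ
        (Set.univ.pi fun i => if i ∈ I then Set.univ else s i) := by
    ext p
    simp only [Set.mem_preimage, Set.mem_pi, Set.mem_univ, true_imp_iff, Set.mem_prod]
    rw [← forall_and]
    refine forall_congr' fun i => ?_
    by_cases hi : i ∈ I <;> simp [hi]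
  rw [this, Measure.prod_prod, Measure.pi_pi, Measure.pi_pi, ← Finset.prod_mul_distrib]
  refine Finset.prod_congr rfl fun i _ => ?_
  by_cases hi : i ∈ I <;> simp [hi]

/-- A conditional bound given the coordinates outside `I` is an unconditional bound. -/
lemma measureReal_le_of_forall_piecewise (I : Finset (Fin m)) {E : Set (Fin m → X)}
    (hE : MeasurableSet E) {c : ℝ} (hc : 0 ≤ c)
    (h : ∀ S', (Measure.pi fun _ : Fin m => P).real {S | I.piecewise S S' ∈ E} ≤ c) :
    (Measure.pi fun _ : Fin m => P).real E ≤ c := by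
  refine ENNReal.toReal_le_of_le_ofReal hc ?_
  have hmp := measurePreserving_piecewise P I
  rw [← hmp.measure_preimage hE.nullMeasurableSet,
    Measure.prod_apply_symm (hmp.measurable hE)]
  calc _ ≤ ∫⁻ _ : Fin m → X, ENNReal.ofReal c ∂(Measure.pi fun _ => P) := by
        refine lintegral_mono fun S' => ?_
        rw [ENNReal.le_ofReal_iff_toReal_le (measure_ne_top _ _) hc]
        exact h S'
    _ = ENNReal.ofReal c := by simp

-- The power is a product over coordinates of factors `a` or `1`, so independence factorizes the
-- integral. This is the moment generating function behind both Chernoff bounds.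
open scoped Classical in
lemma integral_pow_count (I : Finset (Fin m)) {A : Set X} (hA : MeasurableSet A) (a : ℝ) :
    ∫ S, a ^ (I.filter fun i => S i ∈ A).card ∂(Measure.pi fun _ : Fin m => P)
      = (1 + (a - 1) * P.real A) ^ I.card := by
  have h1 : ∀ S : Fin m → X, a ^ (I.filter fun i => S i ∈ A).card
      = ∏ i, (fun (i : Fin m) (x : X) =>
          if i ∈ I then 1 + A.indicator (fun _ => a - 1) x else 1) i (S i) := by
    intro S
    rw [← Finset.prod_const, Finset.prod_filter, ← Finset.prod_subset (Finset.subset_univ I)]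
    · refine Finset.prod_congr rfl fun i hi => ?_
      by_cases h : S i ∈ A <;> simp [hi, h]
    · intro i _ hi
      simp [hi]
  rw [integral_congr_ae (Filter.Eventually.of_forall h1)]
  refine (integral_fintype_prod_eq_prod (𝕜 := ℝ) (μ := fun _ : Fin m => P)
    (fun (i : Fin m) (x : X) =>
      if i ∈ I then 1 + A.indicator (fun _ => a - 1) x else 1)).trans ?_
  rw [← Finset.prod_subset (Finset.subset_univ I), ← Finset.prod_const]
  · refine Finset.prod_congr rfl fun i hi => ?_
    simp only [hi, if_true]
    rw [integral_add (integrable_const _) ((integrable_const _).indicator hA),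
      integral_indicator hA]
    simp [mul_comm]
  · intro i _ hi
    simp [hi]

open scoped Classical in
lemma measurable_count (I : Finset (Fin m)) {A : Set X} (hA : MeasurableSet A) :
    Measurable fun S : Fin m → X => (I.filter fun i => S i ∈ A).card := by
  simp_rw [Finset.card_filter]
  exact Finset.measurable_sum _ fun i _ =>
    Measurable.ite (measurable_pi_apply i hA) measurable_const measurable_const

open scoped Classical in
lemma integrable_pow_count (I : Finset (Fin m)) {A : Set X} (hA : MeasurableSet A) {a : ℝ}
    (ha : 0 ≤ a) :
    Integrable (fun S : Fin m → X => a ^ (I.filter fun i => S i ∈ A).card)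
      (Measure.pi fun _ : Fin m => P) := by
  refine Integrable.of_mem_Icc 0 ((1 + a) ^ I.card) ?_ (Filter.Eventually.of_forall fun S => ?_)
  · exact (measurable_from_top (f := fun n : ℕ => a ^ n)).comp_aemeasurable
      (measurable_count I hA).aemeasurable
  · refine ⟨by positivity, ?_⟩
    calc a ^ (I.filter fun i => S i ∈ A).card ≤ (1 + a) ^ (I.filter fun i => S i ∈ A).card := by
          gcongr; linarith
      _ ≤ (1 + a) ^ I.card :=
          pow_le_pow_right₀ (by linarith) (Finset.card_filter_le _ _)

open scoped Classical in
/-- Multiplicative Chernoff bound, lower tail. -/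
lemma measureReal_count_le (I : Finset (Fin m)) {A : Set X} (hA : MeasurableSet A) {p : ℝ}
    (hp : 0 ≤ p) (hpA : p ≤ P.real A) :
    (Measure.pi fun _ : Fin m => P).real
      {S | ((I.filter fun i => S i ∈ A).card : ℝ) ≤ p / 2 * I.card}
      ≤ Real.exp (-(p * I.card) / 8) := by
  set μ := Measure.pi fun _ : Fin m => P
  -- Markov for `2 ^ (-count)`. The resulting exponent is `-(1 - log 2) / 2` times `p |I|`, and `(1
  -- - log 2) / 2 > 1 / 8`.
  have hmarkov := mul_meas_ge_le_integral_of_nonneg (μ := μ)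
    (f := fun S : Fin m → X => (1 / 2 : ℝ) ^ (I.filter fun i => S i ∈ A).card)
    (Filter.Eventually.of_forall fun S => by positivity)
    (integrable_pow_count P I hA (by norm_num)) (Real.exp (-Real.log 2 * (p / 2 * I.card)))
  rw [integral_pow_count P I hA] at hmarkov
  have hP1 : P.real A ≤ 1 := measureReal_le_one
  have h2 : (1 + (1 / 2 - 1) * P.real A) ^ I.card ≤ Real.exp (-(p * I.card) / 2) := by
    have : 1 + (1 / 2 - 1) * P.real A ≤ Real.exp (-p / 2) := by
      have := Real.add_one_le_exp (-p / 2)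
      linarith
    calc _ ≤ Real.exp (-p / 2) ^ I.card := pow_le_pow_left₀ (by linarith) this _
      _ = _ := by rw [← Real.exp_nat_mul]; congr 1; ring
  have h3 : {S : Fin m → X | ((I.filter fun i => S i ∈ A).card : ℝ) ≤ p / 2 * I.card} ⊆
      {S | Real.exp (-Real.log 2 * (p / 2 * I.card))
        ≤ (1 / 2 : ℝ) ^ (I.filter fun i => S i ∈ A).card} := by
    intro S hS
    simp only [Set.mem_ofPred_eq] at hS ⊢
    have : (1 / 2 : ℝ) = Real.exp (-Real.log 2) := by
      rw [Real.exp_neg, Real.exp_log (by norm_num)]; norm_num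
    rw [this, ← Real.exp_nat_mul, Real.exp_le_exp]
    nlinarith [Real.log_two_gt_d9]
  have h4 : μ.real {S : Fin m → X | ((I.filter fun i => S i ∈ A).card : ℝ) ≤ p / 2 * I.card}
      * Real.exp (-Real.log 2 * (p / 2 * I.card)) ≤ Real.exp (-(p * I.card) / 2) := by
    refine le_trans ?_ (hmarkov.trans h2)
    rw [mul_comm]
    exact mul_le_mul_of_nonneg_left (measureReal_mono h3) (Real.exp_pos _).le
  rw [← le_div_iff₀ (Real.exp_pos _), ← Real.exp_sub] at h4
  refine h4.trans (Real.exp_le_exp.2 ?_)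
  have : 0 ≤ p * I.card := by positivity
  nlinarith [Real.log_two_lt_d9]

open scoped Classical in
/-- Multiplicative Chernoff bound, upper tail. -/
lemma measureReal_le_count (I : Finset (Fin m)) {A : Set X} (hA : MeasurableSet A) {p : ℝ}
    (hpA : P.real A ≤ p) :
    (Measure.pi fun _ : Fin m => P).real
      {S | 2 * p * I.card ≤ ((I.filter fun i => S i ∈ A).card : ℝ)}
      ≤ Real.exp (-(p * I.card) / 3) := by
  set μ := Measure.pi fun _ : Fin m => P
  -- Markov for `2 ^ count`. The resulting exponent is `1 - 2 log 2` times `p |I|`, and `2 log 2 - 1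
  -- > 1 / 3`.
  have hmarkov := mul_meas_ge_le_integral_of_nonneg (μ := μ)
    (f := fun S : Fin m → X => (2 : ℝ) ^ (I.filter fun i => S i ∈ A).card)
    (Filter.Eventually.of_forall fun S => by positivity)
    (integrable_pow_count P I hA (by norm_num)) (Real.exp (Real.log 2 * (2 * p * I.card)))
  rw [integral_pow_count P I hA] at hmarkov
  have hP0 : 0 ≤ P.real A := measureReal_nonneg
  have h2 : (1 + (2 - 1) * P.real A) ^ I.card ≤ Real.exp (p * I.card) := by
    have : 1 + (2 - 1) * P.real A ≤ Real.exp p := by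
      have := Real.add_one_le_exp p
      linarith
    calc _ ≤ Real.exp p ^ I.card := pow_le_pow_left₀ (by linarith) this _
      _ = _ := by rw [← Real.exp_nat_mul]; congr 1; ring
  have h3 : {S : Fin m → X | 2 * p * I.card ≤ ((I.filter fun i => S i ∈ A).card : ℝ)} ⊆
      {S | Real.exp (Real.log 2 * (2 * p * I.card))
        ≤ (2 : ℝ) ^ (I.filter fun i => S i ∈ A).card} := by
    intro S hS
    simp only [Set.mem_ofPred_eq] at hS ⊢
    rw [← Real.rpow_natCast, Real.rpow_def_of_pos (by norm_num), Real.exp_le_exp]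
    nlinarith [Real.log_two_gt_d9]
  have h4 : μ.real {S : Fin m → X | 2 * p * I.card ≤ ((I.filter fun i => S i ∈ A).card : ℝ)}
      * Real.exp (Real.log 2 * (2 * p * I.card)) ≤ Real.exp (p * I.card) := by
    refine le_trans ?_ (hmarkov.trans h2)
    rw [mul_comm]
    exact mul_le_mul_of_nonneg_left (measureReal_mono h3) (Real.exp_pos _).le
  rw [← le_div_iff₀ (Real.exp_pos _), ← Real.exp_sub] at h4
  refine h4.trans (Real.exp_le_exp.2 ?_)
  have : 0 ≤ p * I.card := mul_nonneg (hP0.trans hpA) (by positivity)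
  nlinarith [Real.log_two_gt_d9]

/-- Hoeffding's inequality for the deviation of a sum of `[0, 1]`-valued variables. -/
lemma measureReal_sum_deviation_le (I : Finset (Fin m)) {f : X → ℝ} (hf : Measurable f)
    (h01 : ∀ x, f x ∈ Set.Icc (0 : ℝ) 1) {t : ℝ} (ht : 0 ≤ t) :
    (Measure.pi fun _ : Fin m => P).real {S | t ≤ |∑ i ∈ I, (f (S i) - ∫ x, f x ∂P)|}
      ≤ 2 * Real.exp (-(2 * t ^ 2) / I.card) := by
  set μ := Measure.pi fun _ : Fin m => P
  have hsub : ∀ i : Fin m, HasSubgaussianMGF (fun S : Fin m → X => f (S i) - ∫ x, f x ∂P)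
      ((‖(1 : ℝ) - 0‖₊ / 2) ^ 2) μ := by
    intro i
    have h := hasSubgaussianMGF_of_mem_Icc (μ := μ) (X := fun S : Fin m → X => f (S i))
      (hf.comp (measurable_pi_apply i)).aemeasurable
      (Filter.Eventually.of_forall fun S => h01 (S i))
    have hint : ∫ S : Fin m → X, f (S i) ∂μ = ∫ x, f x ∂P := by
      have := (measurePreserving_eval (fun _ : Fin m => P) i)
      rw [← this.map_eq, integral_map this.measurable.aemeasurable hf.aestronglyMeasurable]
    rwa [hint] at h
  have hind : iIndepFun (fun (i : Fin m) (S : Fin m → X) => f (S i) - ∫ x, f x ∂P) μ :=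
    iIndepFun_pi (μ := fun _ : Fin m => P) (X := fun _ x => f x - ∫ x, f x ∂P)
      fun i => (hf.sub_const _).aemeasurable
  have hind' : iIndepFun (fun (i : Fin m) (S : Fin m → X) => -(f (S i) - ∫ x, f x ∂P)) μ :=
    iIndepFun_pi (μ := fun _ : Fin m => P) (X := fun _ x => -(f x - ∫ x, f x ∂P))
      fun i => (hf.sub_const _).neg.aemeasurable
  have hu := HasSubgaussianMGF.measure_sum_ge_le_of_iIndepFun hind (s := I)
    (fun i _ => hsub i) ht
  have hl := HasSubgaussianMGF.measure_sum_ge_le_of_iIndepFun hind' (s := I)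
    (fun i _ => (hsub i).neg) ht
  -- Each summand has variance proxy `1 / 4`. For empty `I` both quotients are `0` by division by
  -- zero.
  have hexp : -t ^ 2 / (2 * ((∑ _i ∈ I, (‖(1 : ℝ) - 0‖₊ / 2) ^ 2 : NNReal) : ℝ))
      = -(2 * t ^ 2) / I.card := by
    simp
    rcases I.card.eq_zero_or_pos with h | h
    · simp [h]
    · have : (0 : ℝ) < I.card := by exact_mod_cast h
      field_simp
  push_cast at hexp hu hl
  rw [hexp] at hu hl
  calc _ ≤ μ.real ({S | t ≤ ∑ i ∈ I, (f (S i) - ∫ x, f x ∂P)} ∪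
        {S | t ≤ ∑ i ∈ I, -(f (S i) - ∫ x, f x ∂P)}) := by
        refine measureReal_mono fun S hS => ?_
        simp only [Set.mem_ofPred_eq, Set.mem_union, Finset.sum_neg_distrib] at hS ⊢
        exact le_abs.1 hS
    _ ≤ _ := (measureReal_union_le _ _).trans (by linarith)

end Concentration

/-! ### Concentration for sets and functions independent of the tested coordinates -/

section RandomSet

open scoped Classical in
lemma filter_piecewise_mem {X : Type*} {m : ℕ} (I : Finset (Fin m)) (A : Set X)
    (S S' : Fin m → X) :
    (I.filter fun i => I.piecewise S S' i ∈ A) = I.filter fun i => S i ∈ A :=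
  Finset.filter_congr fun i hi => by simp [Finset.piecewise, hi]

variable {X : Type*} [MeasurableSpace X] {m : ℕ} (P : Measure X) [IsProbabilityMeasure P]

open scoped Classical in
lemma measurable_count_of_measurableSet (I : Finset (Fin m)) {A : (Fin m → X) → Set X}
    (hA : MeasurableSet {p : (Fin m → X) × X | p.2 ∈ A p.1}) :
    Measurable fun S : Fin m → X => (I.filter fun i => S i ∈ A S).card := by
  simp_rw [Finset.card_filter]
  refine Finset.measurable_sum _ fun i _ =>
    Measurable.ite ?_ measurable_const measurable_const
  exact (measurable_id.prodMk (measurable_pi_apply i)) hA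

lemma measurable_measureReal_section {A : (Fin m → X) → Set X}
    (hA : MeasurableSet {p : (Fin m → X) × X | p.2 ∈ A p.1}) :
    Measurable fun S : Fin m → X => P.real (A S) :=
  (measurable_measure_prodMk_left hA).ennreal_toReal

open scoped Classical in
/-- Upper-tail Chernoff bound for a random set that is independent of the coordinates in `I`. -/
lemma measureReal_le_count_random (I : Finset (Fin m)) {A : (Fin m → X) → Set X}
    (hA : MeasurableSet {p : (Fin m → X) × X | p.2 ∈ A p.1})
    (hI : ∀ S S', A (I.piecewise S S') = A S') (p : ℝ) :
    (Measure.pi fun _ : Fin m => P).real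
      {S | P.real (A S) ≤ p ∧ 2 * p * I.card ≤ ((I.filter fun i => S i ∈ A S).card : ℝ)}
      ≤ Real.exp (-(p * I.card) / 3) := by
  have hcount : Measurable fun S : Fin m → X => ((I.filter fun i => S i ∈ A S).card : ℝ) :=
    measurable_from_top.comp (measurable_count_of_measurableSet I hA)
  refine measureReal_le_of_forall_piecewise P I
    ((measurableSet_le (measurable_measureReal_section P hA) measurable_const).inter
      (measurableSet_le measurable_const hcount)) (Real.exp_pos _).le fun S' => ?_
  have hAS : MeasurableSet (A S') := measurable_prodMk_left hA
  by_cases hp : P.real (A S') ≤ p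
  · refine le_trans (measureReal_mono fun S hS => ?_)
      (measureReal_le_count P I hAS hp)
    simp only [Set.mem_ofPred_eq, Set.mem_inter_iff, hI, filter_piecewise_mem] at hS ⊢
    exact hS.2
  · refine le_trans (measureReal_mono (s₂ := ∅) fun S hS => ?_) (by simp [(Real.exp_pos _).le])
    simp only [Set.mem_ofPred_eq, Set.mem_inter_iff, hI] at hS
    exact hp hS.1

open scoped Classical in
/-- Lower-tail Chernoff bound for a random set that is independent of the coordinates in `I`. -/
lemma measureReal_count_le_random (I : Finset (Fin m)) {A : (Fin m → X) → Set X}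
    (hA : MeasurableSet {p : (Fin m → X) × X | p.2 ∈ A p.1})
    (hI : ∀ S S', A (I.piecewise S S') = A S') {p : ℝ} (hp0 : 0 ≤ p) :
    (Measure.pi fun _ : Fin m => P).real
      {S | p ≤ P.real (A S) ∧ ((I.filter fun i => S i ∈ A S).card : ℝ) ≤ p / 2 * I.card}
      ≤ Real.exp (-(p * I.card) / 8) := by
  have hcount : Measurable fun S : Fin m → X => ((I.filter fun i => S i ∈ A S).card : ℝ) :=
    measurable_from_top.comp (measurable_count_of_measurableSet I hA)
  refine measureReal_le_of_forall_piecewise P I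
    ((measurableSet_le measurable_const (measurable_measureReal_section P hA)).inter
      (measurableSet_le hcount measurable_const)) (Real.exp_pos _).le fun S' => ?_
  have hAS : MeasurableSet (A S') := measurable_prodMk_left hA
  by_cases hp : p ≤ P.real (A S')
  · refine le_trans (measureReal_mono fun S hS => ?_)
      (measureReal_count_le P I hAS hp0 hp)
    simp only [Set.mem_ofPred_eq, Set.mem_inter_iff, hI, filter_piecewise_mem] at hS ⊢
    exact hS.2
  · refine le_trans (measureReal_mono (s₂ := ∅) fun S hS => ?_) (by simp [(Real.exp_pos _).le])
    simp only [Set.mem_ofPred_eq, Set.mem_inter_iff, hI] at hS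
    exact hp hS.1

/-- Hoeffding's inequality for a random function that is independent of the coordinates in `I`. -/
lemma measureReal_mean_deviation_le_random (I : Finset (Fin m)) (hI0 : I.Nonempty)
    {f : (Fin m → X) → X → ℝ} (hf : Measurable fun p : (Fin m → X) × X => f p.1 p.2)
    (h01 : ∀ S x, f S x ∈ Set.Icc (0 : ℝ) 1)
    (hI : ∀ S S', f (I.piecewise S S') = f S') {ε : ℝ} (hε : 0 ≤ ε) :
    (Measure.pi fun _ : Fin m => P).real
      {S | ε < |(∑ i ∈ I, f S (S i)) / I.card - ∫ x, f S x ∂P|}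
      ≤ 2 * Real.exp (-(2 * ε ^ 2 * I.card)) := by
  have hcard : (0 : ℝ) < I.card := by exact_mod_cast hI0.card_pos
  refine measureReal_le_of_forall_piecewise P I ?_ (by positivity) fun S' => ?_
  · have h1 : Measurable fun S : Fin m → X => ∫ x, f S x ∂P :=
      (hf.stronglyMeasurable.integral_prod_right).measurable
    have h2 : Measurable fun S : Fin m → X => (∑ i ∈ I, f S (S i)) / (I.card : ℝ) :=
      (Finset.measurable_sum _ fun i _ =>
        hf.comp (measurable_id.prodMk (measurable_pi_apply i))).div_const _
    exact measurableSet_lt measurable_const ((h2.sub h1).abs)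
  · have hfS : Measurable (f S') := hf.comp measurable_prodMk_left
    refine le_trans (measureReal_mono fun S hS => ?_)
      ((measureReal_sum_deviation_le P I hfS (h01 S') (t := ε * I.card) (by positivity)).trans
        (le_of_eq ?_))
    · simp only [Set.mem_ofPred_eq, hI] at hS ⊢
      have hs : ∑ i ∈ I, f S' (I.piecewise S S' i) = ∑ i ∈ I, f S' (S i) :=
        Finset.sum_congr rfl fun i hi => by simp [Finset.piecewise, hi]
      rw [hs] at hS
      have : ∑ i ∈ I, (f S' (S i) - ∫ x, f S' x ∂P)
          = ((∑ i ∈ I, f S' (S i)) / I.card - ∫ x, f S' x ∂P) * I.card := by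
        rw [Finset.sum_sub_distrib, Finset.sum_const, nsmul_eq_mul]
        field_simp
      rw [this, abs_mul, abs_of_pos hcard]
      exact (mul_lt_mul_of_pos_right hS hcard).le
    · congr 2
      field_simp

end RandomSet

/-! ### Sizes and disjointness of the sub-samples -/

section Blocks

variable {k m : ℕ}

lemma card_filter_le_lt {a b : ℕ} (hb : b ≤ m) :
    (Finset.univ.filter fun i : Fin m => a ≤ (i : ℕ) ∧ (i : ℕ) < b).card = b - a := by
  rw [← Nat.card_Ico, ← Finset.card_map Fin.valEmbedding]
  congr 1
  ext x
  simp only [Finset.mem_map, Finset.mem_filter, Finset.mem_univ, true_and, Fin.valEmbedding_apply,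
    Finset.mem_Ico]
  exact ⟨by rintro ⟨i, hi, rfl⟩; exact hi, fun hx => ⟨⟨x, by omega⟩, hx, rfl⟩⟩

lemma mul_blockSize_le (k m : ℕ) : k * blockSize k m ≤ m / 2 - m / 4 :=
  Nat.mul_div_le _ _

lemma add_mul_blockSize_le {j : ℕ} (hj : j < k) : m / 4 + (j + 1) * blockSize k m ≤ m / 2 := by
  have h1 := Nat.mul_le_mul_right (blockSize k m) (Nat.succ_le_of_lt hj)
  have h2 := mul_blockSize_le k m
  simp only [Nat.succ_eq_add_one] at h1
  omega

lemma mem_block {j : ℕ} {i : Fin m} : i ∈ block k m j ↔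
    m / 4 + j * blockSize k m ≤ (i : ℕ) ∧ (i : ℕ) < m / 4 + (j + 1) * blockSize k m := by
  simp [block]

lemma mem_firstBlock {i : Fin m} : i ∈ firstBlock m ↔ (i : ℕ) < m / 4 := by
  simp [firstBlock]

lemma card_block {j : ℕ} (hj : j < k) : (block k m j).card = blockSize k m := by
  have := add_mul_blockSize_le (m := m) hj
  rw [block, card_filter_le_lt (by omega), add_mul]
  omega

lemma card_firstBlock (m : ℕ) : (firstBlock m).card = m / 4 := by
  have h := card_filter_le_lt (m := m) (a := 0) (b := m / 4) (by omega)
  simpa [firstBlock] using h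

lemma lt_half_of_mem_block {j : ℕ} (hj : j < k) {i : Fin m} (hi : i ∈ block k m j) :
    (i : ℕ) < m / 2 :=
  (mem_block.1 hi).2.trans_le (add_mul_blockSize_le hj)

lemma notMem_firstBlock_of_mem_block {j : ℕ} {i : Fin m} (hi : i ∈ block k m j) :
    i ∉ firstBlock m := by
  rw [mem_firstBlock]
  have := (mem_block.1 hi).1
  omega

lemma notMem_block_of_lt {j j' : ℕ} (hj : j < j') {i : Fin m} (hi : i ∈ block k m j) :
    i ∉ block k m j' := by
  rw [mem_block] at *
  have := Nat.mul_le_mul_right (blockSize k m) (Nat.succ_le_of_lt hj)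
  simp only [Nat.succ_eq_add_one] at this
  omega

end Blocks

/-! ### Centers given by time indices -/

section Centers

variable {X : Type*} {m : ℕ}

/-- The multiset of sample points with indices `f`. -/
def centersAt (S : Fin m → X) {j : ℕ} (f : Fin j → Fin m) : Multiset X :=
  (List.ofFn fun a => S (f a) : List X)

lemma setOf_mem_ofFn {j : ℕ} (g : Fin j → X) :
    {z | z ∈ ((List.ofFn g : List X) : Multiset X)} = Set.range g := by
  ext z
  simp [List.mem_ofFn]

lemma setOf_mem_centersAt (S : Fin m → X) {j : ℕ} (f : Fin j → Fin m) :
    {z | z ∈ centersAt S f} = Set.range fun a => S (f a) :=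
  setOf_mem_ofFn _

lemma card_centersAt (S : Fin m → X) {j : ℕ} (f : Fin j → Fin m) :
    (centersAt S f).card = j := by
  simp [centersAt]

end Centers

/-! ### Measurability of risk and goodness -/

section Measurability

variable {X : Type*} [MetricSpace X] [MeasurableSpace X] {Ω : Type*} [MeasurableSpace Ω]

/-- With finitely many centers, a sublevel set is a finite union of sets `dist < c`. Joint
measurability of the distance is thus enough, with no Borel or separability assumption. -/
lemma measurable_infDist_list (hd : Measurable fun p : X × X => dist p.1 p.2) {y : Ω → X}
    (hy : Measurable y) (zs : List (Ω → X)) (hz : ∀ z ∈ zs, Measurable z) :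
    Measurable fun ω =>
      Metric.infDist (y ω) {x | x ∈ ((zs.map fun z => z ω : List X) : Multiset X)} := by
  rcases eq_or_ne zs [] with rfl | hne
  · simp
  refine measurable_of_Iio fun c => ?_
  have : (fun ω => Metric.infDist (y ω) {x | x ∈ ((zs.map fun z => z ω : List X) : Multiset X)})
      ⁻¹' Set.Iio c = ⋃ z ∈ {z | z ∈ zs}, {ω | dist (y ω) (z ω) < c} := by
    ext ω
    obtain ⟨z, hz⟩ := List.exists_mem_of_ne_nil zs hne
    have hn : {x | x ∈ ((zs.map fun z => z ω : List X) : Multiset X)}.Nonempty :=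
      ⟨z ω, by simpa using ⟨z, hz, rfl⟩⟩
    rw [Set.mem_preimage, Set.mem_Iio, Metric.infDist_lt_iff hn]
    simp
  rw [this]
  refine MeasurableSet.biUnion zs.finite_toSet.countable fun z hzm => ?_
  exact measurableSet_lt (hd.comp (hy.prodMk (hz z hzm))) measurable_const

lemma measurable_infDist_range (hd : Measurable fun p : X × X => dist p.1 p.2) {y : Ω → X}
    (hy : Measurable y) {j : ℕ} {g : Fin j → Ω → X} (hg : ∀ a, Measurable (g a)) :
    Measurable fun ω => Metric.infDist (y ω) (Set.range fun a => g a ω) := by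
  have h := measurable_infDist_list hd hy (List.ofFn g) (by
    intro z hz
    obtain ⟨a, rfl⟩ := List.mem_ofFn.1 hz
    exact hg a)
  convert h using 3 with ω
  rw [List.map_ofFn, setOf_mem_ofFn]
  rfl

lemma measurable_empRisk (hd : Measurable fun p : X × X => dist p.1 p.2) {m : ℕ}
    {S : Ω → Fin m → X} (hS : Measurable S) (I : Finset (Fin m)) (zs : List (Ω → X))
    (hz : ∀ z ∈ zs, Measurable z) :
    Measurable fun ω =>
      empRisk (S ω) I {x | x ∈ ((zs.map fun z => z ω : List X) : Multiset X)} :=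
  (Finset.measurable_sum _ fun i _ =>
    measurable_infDist_list hd ((measurable_pi_apply i).comp hS) zs hz).div_const _

/-- The centers are a list of measurable maps, so that the induction can prepend the random point `S
i` that the recursion adds. -/
lemma measurableSet_goodAux (hd : Measurable fun p : X × X => dist p.1 p.2) {m : ℕ}
    {S : Ω → Fin m → X} (hS : Measurable S) (k : ℕ) (r q : ℝ) (n : ℕ) (zs : List (Ω → X))
    (hz : ∀ z ∈ zs, Measurable z) :
    MeasurableSet {ω | GoodAux k (S ω) r q n ((zs.map fun z => z ω : List X) : Multiset X)} := by
  classical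
  induction n generalizing zs with
  | zero => exact measurableSet_le (measurable_empRisk hd hS _ zs hz) measurable_const
  | succ n ih =>
    simp only [GoodAux, Finset.card_filter]
    refine measurableSet_le measurable_const (Measurable.div_const ?_ _)
    refine (measurable_from_top (f := fun a : ℕ => (a : ℝ))).comp
      (Finset.measurable_sum _ fun i _ => Measurable.ite ?_ measurable_const measurable_const)
    have hi : Measurable fun ω => S ω i := (measurable_pi_apply i).comp hS
    exact ih ((fun ω => S ω i) :: zs) fun z hzm => by
      rcases List.mem_cons.1 hzm with rfl | h
      · exact hi
      · exact hz z h

end Measurability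

/-! ### Which coordinates goodness depends on -/

section Locality

variable {X : Type*} [MetricSpace X] {k m : ℕ}

/-- Goodness of a collection that misses `n` centers depends only on `S₀` and on the last `n` of
the sub-samples `S₁, …, S_k`. -/
lemma goodAux_congr {S S' : Fin m → X} (r q : ℝ) {n : ℕ} (hn : n ≤ k)
    (h0 : ∀ i ∈ firstBlock m, S i = S' i)
    (hb : ∀ j, k - n ≤ j → j < k → ∀ i ∈ block k m j, S i = S' i) (Z : Multiset X) :
    GoodAux k S r q n Z ↔ GoodAux k S' r q n Z := by
  classical
  induction n generalizing Z with
  | zero =>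
    simp only [GoodAux, empRisk]
    rw [Finset.sum_congr rfl fun i hi => by rw [h0 i hi]]
  | succ n ih =>
    simp only [GoodAux]
    have : ((block k m (k - (n + 1))).filter fun i => GoodAux k S r q n (S i ::ₘ Z))
        = (block k m (k - (n + 1))).filter fun i => GoodAux k S' r q n (S' i ::ₘ Z) := by
      refine Finset.filter_congr fun i hi => ?_
      rw [ih (by omega) (fun j hj hjk => hb j (by omega) hjk), hb _ le_rfl (by omega) i hi]
    rw [this]

/-- The points that extend the centers with indices `f` to a good collection. -/
def extensions (k : ℕ) (S : Fin m → X) (r q : ℝ) {j : ℕ} (f : Fin j → Fin m) : Set X :=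
  {x | GoodAux k S r q (k - (j + 1)) (x ::ₘ centersAt S f)}

lemma measurableSet_extensions [MeasurableSpace X]
    (hd : Measurable fun p : X × X => dist p.1 p.2) (r q : ℝ) {j : ℕ} (f : Fin j → Fin m) :
    MeasurableSet {p : (Fin m → X) × X | p.2 ∈ extensions k p.1 r q f} := by
  have h := measurableSet_goodAux (Ω := (Fin m → X) × X) hd measurable_fst k r q (k - (j + 1))
    ((fun p => p.2) :: List.ofFn fun a => fun p => p.1 (f a)) (by
      intro z hz
      rcases List.mem_cons.1 hz with rfl | h
      · exact measurable_snd
      · obtain ⟨a, rfl⟩ := List.mem_ofFn.1 h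
        fun_prop)
  convert h using 4 with p
  simp [extensions, centersAt, List.map_ofFn, Function.comp_def]

/-- Extending by one point leaves `k - (j + 1)` centers missing, so only `S₀`, the blocks after
block `j`, and the points at the indices `f` matter. This covers both uses: `I` is block `j` itself,
or a window after all indices in `f`. -/
lemma extensions_piecewise (r q : ℝ) {j : ℕ} (hj : j < k) {f : Fin j → Fin m}
    {I : Finset (Fin m)} (h0 : ∀ i ∈ I, i ∉ firstBlock m)
    (hb : ∀ i ∈ I, ∀ j', j < j' → j' < k → i ∉ block k m j') (hf : ∀ a, f a ∉ I)
    (S S' : Fin m → X) :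
    extensions k (I.piecewise S S') r q f = extensions k S' r q f := by
  have hc : centersAt (I.piecewise S S') f = centersAt S' f := by
    simp [centersAt, hf]
  ext x
  simp only [extensions, Set.mem_ofPred_eq, hc]
  refine goodAux_congr r q (by omega) (fun i hi => ?_) (fun j' hj' hj'k i hi => ?_) _
  · exact Finset.piecewise_eq_of_notMem _ _ _ fun h => h0 i h hi
  · exact Finset.piecewise_eq_of_notMem _ _ _ fun h => hb i h j' (by omega) hj'k hi

end Locality

/-! ### Quantile balls and the doubling of the risk -/

open ProbabilityTheory in
/-- A `p`-quantile of a `[0, 1]`-valued random variable. -/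
lemma exists_quantile {X : Type*} [MeasurableSpace X] (P : Measure X)
    [IsProbabilityMeasure P] {f : X → ℝ} (hf : Measurable f) (h01 : ∀ x, f x ∈ Set.Icc (0 : ℝ) 1)
    {p : ℝ} (hp0 : 0 < p) (hp1 : p ≤ 1) :
    ∃ s ≤ 1, p ≤ P.real {x | f x ≤ s} ∧ P.real {x | f x < s} ≤ p := by
  have : IsProbabilityMeasure (P.map f) := Measure.isProbabilityMeasure_map hf.aemeasurable
  set F := cdf (P.map f)
  have hF : ∀ t, F t = P.real {x | f x ≤ t} := fun t => by
    rw [cdf_eq_real, map_measureReal_apply hf measurableSet_Iic]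
    rfl
  have h1 : (1 : ℝ) ∈ {t | p ≤ F t} := by
    have : {x | f x ≤ 1} = Set.univ := Set.eq_univ_of_forall fun x => (h01 x).2
    simpa [hF, this] using hp1
  have hbdd : BddBelow {t | p ≤ F t} := by
    refine ⟨0, fun t ht => ?_⟩
    by_contra! hneg
    have : {x | f x ≤ t} = ∅ :=
      Set.eq_empty_of_forall_notMem fun x hx => by linarith [(h01 x).1, show f x ≤ t from hx]
    rw [Set.mem_ofPred_eq, hF, this, measureReal_empty] at ht
    linarith
  -- Right continuity of the distribution function gives mass at least `p` to the closed ball, and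
  -- its left limit gives mass at most `p` to the open one.
  refine ⟨sInf {t | p ≤ F t}, csInf_le hbdd h1, ?_, ?_⟩
  · rw [← hF]
    have hright := (F.right_continuous (sInf {t | p ≤ F t})).mono Set.Ioi_subset_Ici_self
    refine ge_of_tendsto hright ?_
    filter_upwards [self_mem_nhdsWithin] with t ht
    obtain ⟨u, hu, hut⟩ := exists_lt_of_csInf_lt ⟨1, h1⟩ ht
    exact le_trans hu (F.mono hut.le)
  · have h2 : P.real {x | f x < sInf {t | p ≤ F t}} =
        (P.map f).real (Set.Iio (sInf {t | p ≤ F t})) := by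
      rw [map_measureReal_apply hf measurableSet_Iio]
      rfl
    rw [h2, ← measure_cdf (P.map f), Measure.real,
      StieltjesFunction.measure_Iio _ (tendsto_cdf_atBot _), sub_zero]
    refine ENNReal.toReal_le_of_le_ofReal hp0.le (ENNReal.ofReal_le_ofReal ?_)
    refine le_of_tendsto (F.mono.tendsto_leftLim _) ?_
    filter_upwards [self_mem_nhdsWithin] with t ht
    by_contra! h
    exact absurd (csInf_le hbdd h.le) (not_le.2 ht)

lemma infDist_range_mem_Icc {X : Type*} [MetricSpace X] (hb : ∀ x y : X, dist x y ≤ 1) {k : ℕ} (c : Fin k → X) (y : X) :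
    Metric.infDist y (Set.range c) ∈ Set.Icc (0 : ℝ) 1 := by
  refine ⟨Metric.infDist_nonneg, ?_⟩
  rcases isEmpty_or_nonempty (Fin k) with h | ⟨⟨a⟩⟩
  · simp [Set.range_eq_empty]
  · exact (Metric.infDist_le_dist_of_mem (Set.mem_range_self a)).trans (hb _ _)

section Balls

variable {X : Type*} [MetricSpace X] [MeasurableSpace X] (P : Measure X) [IsProbabilityMeasure P]

lemma integrable_infDist_range (hd : Measurable fun p : X × X => dist p.1 p.2)
    (hb : ∀ x y : X, dist x y ≤ 1) {k : ℕ} (c : Fin k → X) :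
    Integrable (fun y => Metric.infDist y (Set.range c)) P :=
  Integrable.of_mem_Icc 0 1
    (measurable_infDist_range hd measurable_id fun a => measurable_const (a := c a)).aemeasurable
    (Filter.Eventually.of_forall fun y => infDist_range_mem_Icc hb c y)

lemma risk_range_mem_Icc (hd : Measurable fun p : X × X => dist p.1 p.2)
    (hb : ∀ x y : X, dist x y ≤ 1) {k : ℕ} (c : Fin k → X) :
    risk P (Set.range c) ∈ Set.Icc (0 : ℝ) 1 := by
  refine ⟨integral_nonneg fun y => Metric.infDist_nonneg, ?_⟩
  refine (integral_mono (integrable_infDist_range P hd hb c) (integrable_const (1 : ℝ))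
    fun y => (infDist_range_mem_Icc hb c y).2).trans (by simp)

/-- Replacing each center by a point at distance at most the `p`-quantile of the distance to that
center at most doubles the risk, up to an additive `k p`. -/
lemma risk_le_two_mul_risk_add (hd : Measurable fun p : X × X => dist p.1 p.2)
    (hb : ∀ x y : X, dist x y ≤ 1) {k : ℕ} (hk : 1 ≤ k) (c x : Fin k → X) (s : Fin k → ℝ)
    (hs : ∀ i, s i ≤ 1) (hx : ∀ i, dist (x i) (c i) ≤ s i) {p : ℝ}
    (hp : ∀ i, P.real {y | dist y (c i) < s i} ≤ p) :
    risk P (Set.range x) ≤ 2 * risk P (Set.range c) + k * p := by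
  have : Nonempty (Fin k) := ⟨⟨0, hk⟩⟩
  have hmeas : ∀ i, MeasurableSet {y | dist y (c i) < s i} := fun i =>
    measurableSet_lt (hd.comp (measurable_id.prodMk measurable_const)) measurable_const
  have hint : ∀ i, Integrable ({y | dist y (c i) < s i}.indicator fun _ => (1 : ℝ)) P :=
    fun i => (integrable_const _).indicator (hmeas i)
  have hpt : ∀ y, Metric.infDist y (Set.range x) ≤ 2 * Metric.infDist y (Set.range c)
      + ∑ i, {y | dist y (c i) < s i}.indicator (fun _ => (1 : ℝ)) y := by
    intro y
    obtain ⟨_, ⟨i, rfl⟩, hi⟩ :=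
      (Set.finite_range c).isCompact.exists_infDist_eq_dist (Set.range_nonempty c) y
    have h1 : Metric.infDist y (Set.range x) ≤ dist y (x i) :=
      Metric.infDist_le_dist_of_mem (Set.mem_range_self i)
    have h2 := dist_triangle_right y (x i) (c i)
    have h3 : ∀ j ∈ Finset.univ,
        0 ≤ {y | dist y (c j) < s j}.indicator (fun _ => (1 : ℝ)) y :=
      fun j _ => Set.indicator_nonneg (fun _ _ => zero_le_one) _
    rw [hi]
    -- Inside the open ball the extra cost `s i ≤ 1` is paid by the indicator. Outside it, `s i ≤
    -- dist y (c i)` makes the cost at most double.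
    by_cases h : dist y (c i) < s i
    · have h4 := Finset.single_le_sum h3 (Finset.mem_univ i)
      rw [Set.indicator_of_mem (by exact h)] at h4
      linarith [hx i, hs i, dist_nonneg (x := y) (y := c i)]
    · linarith [Finset.sum_nonneg h3, hx i]
  have hsum : Integrable
      (fun y => ∑ i, {y | dist y (c i) < s i}.indicator (fun _ => (1 : ℝ)) y) P :=
    integrable_finsetSum _ fun i _ => hint i
  have hc2 := (integrable_infDist_range P hd hb c).const_mul 2
  calc risk P (Set.range x)
      ≤ ∫ y, (2 * Metric.infDist y (Set.range c)
        + ∑ i, {y | dist y (c i) < s i}.indicator (fun _ => (1 : ℝ)) y) ∂P :=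
        integral_mono (integrable_infDist_range P hd hb x) (hc2.add hsum) hpt
    _ = 2 * risk P (Set.range c) + ∑ i, P.real {y | dist y (c i) < s i} := by
        rw [integral_add hc2 hsum, integral_const_mul, integral_finsetSum _ fun i _ => hint i]
        simp_rw [integral_indicator (hmeas _)]
        simp [risk]
    _ ≤ _ := by
        have := Finset.sum_le_sum fun i (_ : i ∈ Finset.univ) => hp i
        simp only [Finset.sum_const, Finset.card_univ, Fintype.card_fin, nsmul_eq_mul] at this
        linarith

end Balls

/-! ### Goodness of the empty collection and the chosen threshold -/

section Goodness

variable {X : Type*} [MetricSpace X] {k m : ℕ}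

open scoped Classical in
/-- If many points of each sub-sample `S_{j+1}` lie in `B j` and every choice of one point from
each `B j` has small empirical risk, then the empty collection is good. -/
lemma good_zero_of_frequent (hm : 0 < m) (S : Fin m → X) {r q : ℝ} (B : Fin k → Set X)
    (hpos : 0 < blockSize k m)
    (hfreq : ∀ j : Fin k, 2 * q * (block k m j).card
      ≤ (((block k m j).filter fun i => S i ∈ B j).card : ℝ))
    (hfin : ∀ f : Fin k → Fin m, (∀ j : Fin k, f j ∈ block k m j ∧ S (f j) ∈ B j) →
      empRisk S (firstBlock m) (Set.range fun a => S (f a)) ≤ r) :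
    Good k S r q 0 := by
  -- Induction on the number `n` of missing centers. Only the first `k - n` values of `g` matter,
  -- and the inductive step overwrites the next one by `Function.update`.
  have key : ∀ n ≤ k, ∀ g : ℕ → Fin m,
      (∀ j : Fin k, (j : ℕ) < k - n → g j ∈ block k m j ∧ S (g j) ∈ B j) →
      GoodAux k S r q n ((Multiset.range (k - n)).map fun j => S (g j)) := by
    intro n
    induction n with
    | zero =>
      intro _ g hg
      have : {z | z ∈ (Multiset.range (k - 0)).map fun j => S (g j)}
          = Set.range fun a : Fin k => S (g a) := by
        ext z
        simp only [Multiset.mem_map, Multiset.mem_range, Set.mem_ofPred_eq, Set.mem_range]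
        exact ⟨by rintro ⟨j, hj, rfl⟩; exact ⟨⟨j, by omega⟩, rfl⟩,
          by rintro ⟨j, rfl⟩; exact ⟨j, by omega, rfl⟩⟩
      simp only [GoodAux, this]
      exact hfin (fun a => g a) fun j => hg j (by omega)
    | succ n ih =>
      intro hn g hg
      have hj : k - (n + 1) < k := by omega
      have hcard : (0 : ℝ) < (block k m (k - (n + 1))).card := by
        rw [card_block hj]
        exact_mod_cast hpos
      simp only [GoodAux]
      rw [le_div_iff₀ hcard]
      refine (hfreq ⟨_, hj⟩).trans (Nat.cast_le.2 (Finset.card_le_card fun i hi => ?_))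
      obtain ⟨hib, hiB⟩ := Finset.mem_filter.1 hi
      refine Finset.mem_filter.2 ⟨hib, ?_⟩
      have h := ih (by omega) (Function.update g (k - (n + 1)) i) fun j hjn => by
        rcases eq_or_ne (j : ℕ) (k - (n + 1)) with h | h
        · have hj' : j = ⟨_, hj⟩ := Fin.ext h
          subst hj'
          simpa using ⟨hib, hiB⟩
        · rw [Function.update_of_ne h]
          exact hg j (by omega)
      have hkn : k - n = (k - (n + 1)) + 1 := by omega
      rw [hkn, Multiset.range_succ, Multiset.map_cons] at h
      convert h using 2
      · simp
      · refine Multiset.map_congr rfl fun j hjr => ?_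
        rw [Function.update_of_ne (Multiset.mem_range.1 hjr).ne]
  refine ⟨by simp, ?_⟩
  have := key k le_rfl (fun _ => ⟨0, hm⟩) (by simp)
  simpa using this

/-- The threshold chosen by the algorithm is good and nearly minimal. -/
lemma exists_chosenThreshold_eq {δ : ℝ} {S : Fin m → X} {R : ℝ}
    (hgood : ∀ n, R ≤ threshold m n → Good k S (threshold m n) (qParam k m δ) 0) {N : ℕ}
    (hN : R ≤ threshold m N) :
    ∃ n ≤ N, chosenThreshold k δ S = threshold m n ∧
      Good k S (threshold m n) (qParam k m δ) 0 ∧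
      threshold m n ≤ max (1 / Real.sqrt m) ((1 + 1 / Real.sqrt m) * R) := by
  have hmem : N ∈ {n : ℕ | Good k S (threshold m n) (qParam k m δ) 0} := hgood N hN
  refine ⟨_, Nat.sInf_le hmem, rfl, Nat.sInf_mem ⟨N, hmem⟩, ?_⟩
  rcases h : sInf {n : ℕ | Good k S (threshold m n) (qParam k m δ) 0} with _ | n
  · simp [threshold]
  -- The preceding candidate is not good, hence lies below `R`, and one step multiplies it by `1 +
  -- β`.
  · have hn : ¬ R ≤ threshold m n := fun hR => by
      have := Nat.sInf_le (s := {n : ℕ | Good k S (threshold m n) (qParam k m δ) 0}) (hgood n hR)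
      omega
    refine le_max_of_le_right ?_
    have : threshold m (n + 1) = (1 + 1 / Real.sqrt m) * threshold m n := by
      simp only [threshold]
      ring
    rw [this]
    exact mul_le_mul_of_nonneg_left (not_le.1 hn).le (by positivity)

/-- By Bernoulli's inequality. It caps the exponents that the union bound must cover. -/
lemma le_threshold_mul (hm : 0 < m) (a : ℕ) : (a : ℝ) ≤ threshold m (a * m) := by
  have hs : 0 < Real.sqrt m := Real.sqrt_pos.2 (by exact_mod_cast hm)
  have h := one_add_mul_le_pow (a := 1 / Real.sqrt m)
    (by have : 0 ≤ 1 / Real.sqrt m := by positivity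
        linarith) (a * m)
  have h2 : ((a * m : ℕ) : ℝ) * (1 / Real.sqrt m) = a * Real.sqrt m := by
    push_cast
    rw [mul_assoc, mul_one_div, Real.div_sqrt]
  rw [threshold, one_div_mul_eq_div, le_div_iff₀ hs]
  linarith

end Goodness

/-! ### The selection phase -/

section Selection

variable {X : Type*} [MetricSpace X] {k m : ℕ}

/-- The centers selected by SKM2 before time `t`. -/
noncomputable def selectedBefore (k : ℕ) {m : ℕ} (δ : ℝ) (S : Fin m → X) (t : ℕ) : Multiset X :=
  (((List.finRange m).take t).filter fun i : Fin m => m / 2 ≤ (i : ℕ)).foldl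
    (fun T i => step k δ S T (S i)) 0

lemma selectedBefore_length (δ : ℝ) (S : Fin m → X) : selectedBefore k δ S m = skm2 k m δ S := by
  rw [selectedBefore, List.take_of_length_le (by simp), skm2]

lemma selectedBefore_zero (δ : ℝ) (S : Fin m → X) : selectedBefore k δ S 0 = 0 := by
  simp [selectedBefore]

lemma selectedBefore_succ (δ : ℝ) (S : Fin m → X) {t : ℕ} (ht : t < m) :
    selectedBefore k δ S (t + 1) =
      if m / 2 ≤ t then step k δ S (selectedBefore k δ S t) (S ⟨t, ht⟩)
      else selectedBefore k δ S t := by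
  have h : (List.finRange m).take (t + 1) = (List.finRange m).take t ++ [⟨t, ht⟩] := by
    rw [List.take_add_one]
    simp [ht]
  rw [selectedBefore, h, List.filter_append, List.foldl_append]
  by_cases h2 : m / 2 ≤ t <;> simp [h2, selectedBefore]

lemma card_selectedBefore_mono (δ : ℝ) (S : Fin m → X) {t u : ℕ} (htu : t ≤ u) (hu : u ≤ m) :
    (selectedBefore k δ S t).card ≤ (selectedBefore k δ S u).card := by
  induction u, htu using Nat.le_induction with
  | base => exact le_rfl
  | succ u _ ih =>
    refine (ih (by omega)).trans ?_
    rw [selectedBefore_succ δ S (by omega)]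
    split_ifs
    · rw [step]
      split_ifs <;> simp
    · exact le_rfl

/-- The selected centers are good sample points from the second half of the sequence. -/
lemma selectedBefore_spec {δ : ℝ} {S : Fin m → X}
    (h0 : Good k S (chosenThreshold k δ S) (qParam k m δ) 0) {t : ℕ} (ht : t ≤ m) :
    Good k S (chosenThreshold k δ S) (qParam k m δ) (selectedBefore k δ S t) ∧
      ∃ l : List (Fin m), (∀ i ∈ l, m / 2 ≤ (i : ℕ) ∧ (i : ℕ) < t) ∧
        selectedBefore k δ S t = (l.map S : List X) := by
  induction t with
  | zero => exact ⟨by rwa [selectedBefore_zero], [], by simp, by simp [selectedBefore_zero]⟩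
  | succ t ih =>
    obtain ⟨hg, l, hl, heq⟩ := ih (by omega)
    rw [selectedBefore_succ δ S (by omega)]
    have hold : ∀ i ∈ l, m / 2 ≤ (i : ℕ) ∧ (i : ℕ) < t + 1 := fun i hi =>
      ⟨(hl i hi).1, (hl i hi).2.trans (Nat.lt_succ_self t)⟩
    split_ifs with h
    · rw [step]
      split_ifs with h2
      · refine ⟨h2.2, ⟨t, by omega⟩ :: l, fun i hi => ?_, by simp [heq]⟩
        rcases List.mem_cons.1 hi with rfl | hi
        · exact ⟨h, Nat.lt_succ_self t⟩
        · exact hold i hi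
      · exact ⟨hg, l, hold, heq⟩
    · exact ⟨hg, l, hold, heq⟩

lemma exists_selectedBefore_eq_centersAt {δ : ℝ} {S : Fin m → X}
    (h0 : Good k S (chosenThreshold k δ S) (qParam k m δ) 0) {t : ℕ} (ht : t ≤ m) {j : ℕ}
    (hj : (selectedBefore k δ S t).card = j) :
    ∃ f : Fin j → Fin m, (∀ a, m / 2 ≤ (f a : ℕ) ∧ (f a : ℕ) < t) ∧
      selectedBefore k δ S t = centersAt S f := by
  obtain ⟨-, l, hl, heq⟩ := selectedBefore_spec h0 ht
  have hlen : l.length = j := by rw [← hj, heq]; simp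
  subst hlen
  refine ⟨l.get, fun a => hl _ (l.get_mem a), ?_⟩
  rw [heq, centersAt]
  congr 1
  conv_lhs => rw [← List.ofFn_get l, List.map_ofFn]
  rfl

/-- The times of the `j`-th of `k` consecutive windows in the second half of the sequence. -/
def window (k m j : ℕ) : Finset (Fin m) :=
  Finset.univ.filter fun i =>
    m / 2 + j * (m / 2 / k) ≤ (i : ℕ) ∧ (i : ℕ) < m / 2 + (j + 1) * (m / 2 / k)

lemma window_end_le {j : ℕ} (hj : j ≤ k) : m / 2 + j * (m / 2 / k) ≤ m := by
  have h1 := Nat.mul_le_mul_right (m / 2 / k) hj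
  have h2 := Nat.mul_div_le (m / 2) k
  omega

lemma mem_window {j : ℕ} {i : Fin m} : i ∈ window k m j ↔
    m / 2 + j * (m / 2 / k) ≤ (i : ℕ) ∧ (i : ℕ) < m / 2 + (j + 1) * (m / 2 / k) := by
  simp [window]

lemma card_window {j : ℕ} (hj : j < k) : (window k m j).card = m / 2 / k := by
  rw [window, card_filter_le_lt (window_end_le hj), Nat.succ_mul, Nat.add_sub_add_left,
    Nat.add_sub_cancel_left]

/-- If in each window some point extends the centers selected before the window, then SKM2 selects
`k` centers. -/
lemma card_skm2 {δ : ℝ} {S : Fin m → X}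
    (h0 : Good k S (chosenThreshold k δ S) (qParam k m δ) 0)
    (hwin : ∀ j < k, ∀ f : Fin j → Fin m,
      (∀ a, m / 2 ≤ (f a : ℕ) ∧ (f a : ℕ) < m / 2 + j * (m / 2 / k)) →
      Good k S (chosenThreshold k δ S) (qParam k m δ) (centersAt S f) →
      ∃ i ∈ window k m j, S i ∈ extensions k S (chosenThreshold k δ S) (qParam k m δ) f) :
    (skm2 k m δ S).card = k := by
  -- At least `j` centers are selected before window `j`. Otherwise some window would start and end
  -- with exactly `j` centers, the collection would be constant inside it, and the extending point
  -- provided by `hwin` would have been accepted.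
  have key : ∀ j ≤ k, j ≤ (selectedBefore k δ S (m / 2 + j * (m / 2 / k))).card := by
    intro j
    induction j with
    | zero => simp
    | succ j ih =>
      intro hj
      set t₀ := m / 2 + j * (m / 2 / k) with ht₀
      have ht₀m : t₀ ≤ m := window_end_le (by omega)
      have hend := window_end_le (k := k) (m := m) hj
      have hle : t₀ ≤ m / 2 + (j + 1) * (m / 2 / k) := by
        rw [add_mul]; omega
      by_contra! hlt
      have hcard : (selectedBefore k δ S t₀).card = j :=
        le_antisymm
          ((card_selectedBefore_mono δ S hle hend).trans (Nat.lt_succ_iff.1 hlt))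
          (ih (by omega))
      obtain ⟨f, hf, hfeq⟩ := exists_selectedBefore_eq_centersAt h0 ht₀m hcard
      have hg := (selectedBefore_spec h0 ht₀m).1
      rw [hfeq] at hg
      obtain ⟨i, hi, hie⟩ := hwin j (by omega) f hf hg
      rw [mem_window] at hi
      have hconst : ∀ u, t₀ ≤ u → u ≤ m / 2 + (j + 1) * (m / 2 / k) →
          selectedBefore k δ S u = centersAt S f := by
        intro u hu
        induction u, hu using Nat.le_induction with
        | base => exact fun _ => hfeq
        | succ u hu ihu =>
          intro hue
          have hcu := card_selectedBefore_mono (k := k) δ S hue hend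
          rw [selectedBefore_succ δ S (by omega)] at hcu ⊢
          rw [ihu (by omega)] at hcu ⊢
          split_ifs at hcu ⊢
          · rw [step] at hcu ⊢
            split_ifs at hcu ⊢
            · rw [Multiset.card_cons, card_centersAt] at hcu
              omega
            · rfl
          · rfl
      have h1 := hconst i hi.1 hi.2.le
      have h2 := hconst (i + 1) (by omega) hi.2
      rw [selectedBefore_succ δ S i.2, if_pos (by omega), h1, step, if_pos] at h2
      · have := congrArg Multiset.card h2
        simp at this
      · refine ⟨by rw [card_centersAt]; omega, ?_, ?_⟩
        · rw [Multiset.card_cons, card_centersAt]; omega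
        · rw [Multiset.card_cons, card_centersAt]
          exact hie
  refine le_antisymm ?_ ?_
  · rw [← selectedBefore_length]
    exact (selectedBefore_spec h0 le_rfl).1.1
  · rw [← selectedBefore_length]
    exact (key k le_rfl).trans (card_selectedBefore_mono δ S (window_end_le le_rfl) le_rfl)

end Selection

/-! ### Regular samples and the union bound -/

section Guarantee

variable {X : Type*} [MetricSpace X] [MeasurableSpace X] {k m : ℕ}

open scoped Classical in
/-- The guarantee of SKM2 on a sample without unlikely deviations. -/
lemma skm2_spec_of_regular (P : Measure X) [IsProbabilityMeasure P]
    (hd : Measurable fun p : X × X => dist p.1 p.2) (hb : ∀ x y : X, dist x y ≤ 1) {δ : ℝ}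
    (hk : 1 ≤ k) (hm : 0 < m) (hpos : 0 < blockSize k m) (c : Fin k → X) (s : Fin k → ℝ)
    (hs : ∀ j, s j ≤ 1) {q ε : ℝ} (hq : q = qParam k m δ)
    (hps : ∀ j, P.real {x | dist x (c j) < s j} ≤ 4 * q)
    (hR : 2 * risk P (Set.range c) + k * (4 * q) + ε ≤ 4) (S : Fin m → X)
    (hball : ∀ j : Fin k, 2 * q * (block k m j).card
      ≤ (((block k m j).filter fun i => S i ∈ {x | dist x (c j) ≤ s j}).card : ℝ))
    (hdev : ∀ f : Fin k → Fin m, (∀ a, f a ∉ firstBlock m) →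
      |empRisk S (firstBlock m) (Set.range fun a => S (f a))
        - risk P (Set.range fun a => S (f a))| ≤ ε)
    (hext : ∀ j < k, ∀ f : Fin j → Fin m, ∀ n ≤ 4 * m, (∀ a, m / 2 ≤ (f a : ℕ)) →
      2 * q * (block k m j).card
        ≤ (((block k m j).filter fun i => S i ∈ extensions k S (threshold m n) q f).card : ℝ) →
      q ≤ P.real (extensions k S (threshold m n) q f))
    (hhit : ∀ j < k, ∀ f : Fin j → Fin m, ∀ n ≤ 4 * m,
      (∀ a, m / 2 ≤ (f a : ℕ) ∧ (f a : ℕ) < m / 2 + j * (m / 2 / k)) →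
      q ≤ P.real (extensions k S (threshold m n) q f) →
      ∃ i ∈ window k m j, S i ∈ extensions k S (threshold m n) q f) :
    (skm2 k m δ S).card = k ∧
      risk P {t | t ∈ skm2 k m δ S} ≤
        max (1 / Real.sqrt m)
          ((1 + 1 / Real.sqrt m) * (2 * risk P (Set.range c) + k * (4 * q) + ε)) + ε := by
  have hgood : ∀ n, 2 * risk P (Set.range c) + k * (4 * q) + ε ≤ threshold m n →
      Good k S (threshold m n) (qParam k m δ) 0 := by
    intro n hn
    rw [← hq]
    refine good_zero_of_frequent hm S _ hpos hball fun f hf => ?_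
    have h1 := (abs_le.1 (hdev f fun a => notMem_firstBlock_of_mem_block (hf a).1)).2
    have h2 := risk_le_two_mul_risk_add P hd hb hk c (fun a => S (f a)) s hs
      (fun a => (hf a).2) hps
    linarith
  -- Since `R ≤ 4 ≤ threshold m (4 * m)`, the chosen exponent is at most `4 * m`.
  obtain ⟨n, hn, heq, hzero, hle⟩ := exists_chosenThreshold_eq hgood (N := 4 * m)
    (hR.trans (by exact_mod_cast le_threshold_mul hm 4))
  have hzero' := hzero
  rw [← heq] at hzero'
  have hcard : (skm2 k m δ S).card = k := by
    refine card_skm2 hzero' fun j hj f hf hg => ?_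
    rw [heq, ← hq] at hg ⊢
    refine hhit j hj f n hn hf (hext j hj f n hn (fun a => (hf a).1) ?_)
    have hcardpos : (0 : ℝ) < (block k m j).card := by
      rw [card_block hj]
      exact_mod_cast hpos
    have hg2 := hg.2
    rw [card_centersAt] at hg2
    have hkj : k - j = (k - (j + 1)) + 1 := by omega
    have hkj' : k - (k - (j + 1) + 1) = j := by omega
    rw [hkj] at hg2
    simp only [GoodAux] at hg2
    rw [hkj', le_div_iff₀ hcardpos] at hg2
    exact hg2
  refine ⟨hcard, ?_⟩
  rw [← selectedBefore_length] at hcard ⊢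
  obtain ⟨f, hf, hfeq⟩ := exists_selectedBefore_eq_centersAt hzero' le_rfl hcard
  have hg := ((selectedBefore_spec hzero' le_rfl).1).2
  rw [hcard, Nat.sub_self, hfeq, heq] at hg
  simp only [GoodAux, setOf_mem_centersAt] at hg
  rw [hfeq, setOf_mem_centersAt]
  have h1 := (abs_le.1 (hdev f fun a => by
    rw [mem_firstBlock]
    have := (hf a).1
    omega)).1
  linarith

lemma measureReal_iUnion_le_card_mul {Ω ι : Type*} [MeasurableSpace Ω] (μ : Measure Ω)
    [Fintype ι] (E : ι → Set Ω) {e : ℝ} (hE : ∀ i, μ.real (E i) ≤ e) :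
    μ.real (⋃ i, E i) ≤ Fintype.card ι * e :=
  (measureReal_iUnion_fintype_le E).trans
    ((Finset.sum_le_sum fun i _ => hE i).trans (by simp))

/-- Lets the union bound run over all index tuples: a tuple violating the deterministic condition
`p` contributes an empty event. -/
lemma measureReal_setOf_and_le {Ω : Type*} [MeasurableSpace Ω] (μ : Measure Ω)
    [IsProbabilityMeasure μ] {p : Prop} {E : Set Ω} {e : ℝ} (he : 0 ≤ e)
    (h : p → μ.real E ≤ e) : μ.real {ω | p ∧ ω ∈ E} ≤ e := by
  by_cases hp : p
  · simpa [hp] using h hp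
  · simpa [hp] using he

/-- The number of choices of at most `k - 1` indices and of a threshold. -/
lemma card_sigma_le (k m N : ℕ) (hm : 0 < m) :
    (Fintype.card (Σ j : Fin k, (Fin j → Fin m) × Fin N) : ℝ) * m ≤ k * m ^ k * N := by
  have : Fintype.card (Σ j : Fin k, (Fin j → Fin m) × Fin N) * m ≤ k * m ^ k * N := by
    rw [Fintype.card_sigma, Finset.sum_mul]
    calc _ ≤ ∑ _j : Fin k, m ^ k * N := by
          refine Finset.sum_le_sum fun j _ => ?_
          simp only [Fintype.card_prod, Fintype.card_fun, Fintype.card_fin]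
          calc m ^ (j : ℕ) * N * m = m ^ ((j : ℕ) + 1) * N := by ring
            _ ≤ m ^ k * N := Nat.mul_le_mul_right _ (Nat.pow_le_pow_right hm j.2)
      _ = _ := by simp [mul_assoc]
  exact_mod_cast this

-- Union bound over the failures of the hypotheses of `skm2_spec_of_regular`. The conditions on `Λ`
-- make each Chernoff or Hoeffding exponent at least `Λ`: the `3` serves the upper tail on blocks,
-- the `8` the lower tail on windows.
open scoped Classical in
lemma measureReal_skm2_fails_le (P : Measure X) [IsProbabilityMeasure P]
    (hd : Measurable fun p : X × X => dist p.1 p.2) (hb : ∀ x y : X, dist x y ≤ 1) {δ : ℝ}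
    (hk : 1 ≤ k) (hm : 4 ≤ m) (hpos : 0 < blockSize k m) (c : Fin k → X)
    {q ε Λ : ℝ} (hq : q = qParam k m δ) (hq0 : 0 < q) (hq1 : 4 * q ≤ 1) (hε : 0 ≤ ε)
    (hR : 2 * risk P (Set.range c) + k * (4 * q) + ε ≤ 4)
    (hqb : 3 * Λ ≤ q * blockSize k m) (hqL : 8 * Λ ≤ q * (m / 2 / k : ℕ))
    (hεΛ : Λ ≤ 2 * ε ^ 2 * (m / 4 : ℕ)) (hΛ : 0 ≤ Λ) :
    (Measure.pi fun _ : Fin m => P).real {S | ¬ ((skm2 k m δ S).card = k ∧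
      risk P {t | t ∈ skm2 k m δ S} ≤
        max (1 / Real.sqrt m)
          ((1 + 1 / Real.sqrt m) * (2 * risk P (Set.range c) + k * (4 * q) + ε)) + ε)}
      ≤ 13 * k * m ^ k * Real.exp (-Λ) := by
  set μ := Measure.pi fun _ : Fin m => P
  have hdist : ∀ j, Measurable fun x => dist x (c j) := fun j =>
    hd.comp (measurable_id.prodMk measurable_const)
  -- The level `4q` is twice the fraction `2q` that goodness requires, as the lower Chernoff tail
  -- loses a factor `2`.
  choose s hs1 hs2 hs3 using fun j => exists_quantile P (hdist j)
    (fun x => ⟨dist_nonneg, hb x (c j)⟩) (p := 4 * q) (by linarith) hq1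
  have hexp := Real.exp_pos (-Λ)
  have hmR : (4 : ℝ) ≤ m := by exact_mod_cast hm
  have hkR : (1 : ℝ) ≤ k := by exact_mod_cast hk
  let ι := Σ j : Fin k, (Fin j → Fin m) × Fin (4 * m + 1)
  let A : ι → (Fin m → X) → Set X := fun x S => extensions k S (threshold m x.2.2) q x.2.1
  -- The bad events: `E₁`, a block has few points in its ball; `E₂`, empirical and true risk differ;
  -- `E₃`, a block overestimates a set of extensions; `E₄`, a window has too few points of a heavy
  -- one.
  let E₁ : Fin k → Set (Fin m → X) := fun j =>
    {S | (((block k m j).filter fun i => S i ∈ {x | dist x (c j) ≤ s j}).card : ℝ)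
      ≤ 4 * q / 2 * (block k m j).card}
  let E₂ : (Fin k → Fin m) → Set (Fin m → X) := fun f =>
    {S | (∀ a, f a ∉ firstBlock m) ∧
      S ∈ {S | ε < |empRisk S (firstBlock m) (Set.range fun a => S (f a))
        - risk P (Set.range fun a => S (f a))|}}
  let E₃ : ι → Set (Fin m → X) := fun x =>
    {S | (∀ a, m / 2 ≤ (x.2.1 a : ℕ)) ∧ S ∈ {S | P.real (A x S) ≤ q ∧
      2 * q * (block k m x.1).card ≤ (((block k m x.1).filter fun i => S i ∈ A x S).card : ℝ)}}
  let E₄ : ι → Set (Fin m → X) := fun x =>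
    {S | (∀ a, m / 2 ≤ (x.2.1 a : ℕ) ∧ (x.2.1 a : ℕ) < m / 2 + x.1 * (m / 2 / k)) ∧
      S ∈ {S | q ≤ P.real (A x S) ∧
        (((window k m x.1).filter fun i => S i ∈ A x S).card : ℝ)
          ≤ q / 2 * (window k m x.1).card}}
  have h₁ : ∀ j, μ.real (E₁ j) ≤ Real.exp (-Λ) := by
    intro j
    refine (measureReal_count_le P (block k m j)
      (measurableSet_le (hdist j) measurable_const) (by linarith) (hs2 j)).trans
      (Real.exp_le_exp.2 ?_)
    rw [card_block j.2]
    linarith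
  have h₂ : ∀ f, μ.real (E₂ f) ≤ 2 * Real.exp (-Λ) := by
    intro f
    refine measureReal_setOf_and_le μ (by positivity) fun hf => ?_
    have hne : (firstBlock m).Nonempty := by
      rw [← Finset.card_pos, card_firstBlock]
      omega
    refine (measureReal_mean_deviation_le_random P (firstBlock m) hne
      (f := fun S x => Metric.infDist x (Set.range fun a => S (f a)))
      (measurable_infDist_range hd measurable_snd fun a => by fun_prop)
      (fun S x => infDist_range_mem_Icc hb _ x) (fun S S' => ?_) hε).trans ?_
    · simp [hf]
    · rw [card_firstBlock]
      gcongr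
  have hA : ∀ x, MeasurableSet {p : (Fin m → X) × X | p.2 ∈ A x p.1} := fun x =>
    measurableSet_extensions hd _ _ _
  have h₃ : ∀ x, μ.real (E₃ x) ≤ Real.exp (-Λ) := by
    intro x
    refine measureReal_setOf_and_le μ hexp.le fun hf => ?_
    refine (measureReal_le_count_random P (block k m x.1) (hA x) (fun S S' => ?_) q).trans
      (Real.exp_le_exp.2 ?_)
    · refine extensions_piecewise _ _ x.1.2 (fun i hi => notMem_firstBlock_of_mem_block hi)
        (fun i hi j' hj' _ => notMem_block_of_lt hj' hi) (fun a ha => ?_) S S'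
      have h := lt_half_of_mem_block x.1.2 ha
      have := hf a
      omega
    · rw [card_block x.1.2]
      linarith
  have h₄ : ∀ x, μ.real (E₄ x) ≤ Real.exp (-Λ) := by
    intro x
    refine measureReal_setOf_and_le μ hexp.le fun hf => ?_
    refine (measureReal_count_le_random P (window k m x.1) (hA x) (fun S S' => ?_) hq0.le).trans
      (Real.exp_le_exp.2 ?_)
    · refine extensions_piecewise _ _ x.1.2 (fun i hi => ?_) (fun i hi j' _ hj' hib => ?_)
        (fun a ha => ?_) S S'
      · rw [mem_firstBlock]
        have := (mem_window.1 hi).1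
        omega
      · have := lt_half_of_mem_block hj' hib
        have := (mem_window.1 hi).1
        omega
      · have := (mem_window.1 ha).1
        have := (hf a).2
        omega
    · rw [card_window x.1.2]
      linarith
  have hsub : {S | ¬ ((skm2 k m δ S).card = k ∧
      risk P {t | t ∈ skm2 k m δ S} ≤
        max (1 / Real.sqrt m)
          ((1 + 1 / Real.sqrt m) * (2 * risk P (Set.range c) + k * (4 * q) + ε)) + ε)}
      ⊆ (⋃ j, E₁ j) ∪ (⋃ f, E₂ f) ∪ (⋃ x, E₃ x) ∪ (⋃ x, E₄ x) := by
    intro S hS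
    by_contra hcon
    simp only [Set.mem_union, Set.mem_iUnion, not_or, not_exists] at hcon
    obtain ⟨⟨⟨n₁, n₂⟩, n₃⟩, n₄⟩ := hcon
    refine hS (skm2_spec_of_regular P hd hb hk (by omega) hpos c s hs1 hq hs3 hR S
      (fun j => ?_) (fun f hf => ?_) (fun j hj f n hn hf hfreq => ?_)
      fun j hj f n hn hf hP => ?_)
    · have := n₁ j
      simp only [E₁, Set.mem_ofPred_eq, not_le] at this ⊢
      linarith
    · exact not_lt.1 fun h => n₂ f ⟨hf, h⟩
    · by_contra! h
      exact n₃ ⟨⟨j, hj⟩, f, ⟨n, by omega⟩⟩ ⟨hf, h.le, hfreq⟩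
    · by_contra! h
      refine n₄ ⟨⟨j, hj⟩, f, ⟨n, by omega⟩⟩ ⟨hf, hP, ?_⟩
      rw [Finset.filter_false_of_mem h]
      simp only [Finset.card_empty, Nat.cast_zero]
      positivity
  have hι : (Fintype.card ι : ℝ) ≤ 5 * k * m ^ k := by
    have h := card_sigma_le k m (4 * m + 1) (by omega)
    push_cast at h
    refine le_of_mul_le_mul_right (h.trans ?_) (by linarith : (0 : ℝ) < m)
    have : (0 : ℝ) ≤ k * m ^ k := by positivity
    nlinarith
  have u₁ := measureReal_iUnion_le_card_mul μ E₁ h₁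
  have u₂ := measureReal_iUnion_le_card_mul μ E₂ h₂
  have u₃ := measureReal_iUnion_le_card_mul μ E₃ h₃
  have u₄ := measureReal_iUnion_le_card_mul μ E₄ h₄
  have hmk : (1 : ℝ) ≤ (m : ℝ) ^ k := one_le_pow₀ (by linarith)
  simp only [Fintype.card_fin, Fintype.card_fun, Nat.cast_pow] at u₁ u₂
  have hιe := mul_le_mul_of_nonneg_right hι hexp.le
  have hke : k * Real.exp (-Λ) ≤ k * m ^ k * Real.exp (-Λ) := by
    refine mul_le_mul_of_nonneg_right ?_ hexp.le
    nlinarith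
  have hke2 : (m : ℝ) ^ k * Real.exp (-Λ) ≤ k * m ^ k * Real.exp (-Λ) := by
    refine mul_le_mul_of_nonneg_right ?_ hexp.le
    nlinarith
  -- In units of `k * m ^ k * exp (-Λ)`, the four unions cost at most `1`, `2`, `5` and `5`.
  calc _ ≤ _ := measureReal_mono hsub
    _ ≤ μ.real (⋃ j, E₁ j) + μ.real (⋃ f, E₂ f) + μ.real (⋃ x, E₃ x) + μ.real (⋃ x, E₄ x) :=
      (measureReal_union_le _ _).trans (add_le_add_left ((measureReal_union_le _ _).trans
        (add_le_add_left (measureReal_union_le _ _) _)) _)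
    _ ≤ _ := by linarith

end Guarantee

/-! ### Constants -/

section Numerics

lemma le_eight_mul_blockSize {k m : ℕ} (hk : 1 ≤ k) (hm : 8 * k ≤ m) :
    m ≤ 8 * (k * blockSize k m) := by
  have h := Nat.lt_mul_div_succ (m / 2 - m / 4) hk
  rw [Nat.mul_add] at h
  rw [blockSize]
  generalize k * ((m / 2 - m / 4) / k) = a at *
  omega

lemma le_four_mul_windowSize {k m : ℕ} (hk : 1 ≤ k) (hm : 8 * k ≤ m) :
    m ≤ 4 * (k * (m / 2 / k)) := by
  have h := Nat.lt_mul_div_succ (m / 2) hk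
  rw [Nat.mul_add] at h
  generalize k * (m / 2 / k) = a at *
  omega

/-- The exponential equals `(8m) ^ (-k) * δ / 8`, and `13 k ≤ 8 * 8 ^ k` by Bernoulli's inequality.
-/
lemma mul_pow_mul_exp_le {k m : ℕ} {δ : ℝ} (hm : 0 < m) (hδ : 0 < δ) :
    13 * k * (m : ℝ) ^ k * Real.exp (-(k * Real.log (8 * m) + Real.log (8 / δ))) ≤ δ := by
  have hmR : (0 : ℝ) < m := by exact_mod_cast hm
  have h1 : Real.exp (-(k * Real.log (8 * m) + Real.log (8 / δ)))
      = ((8 : ℝ) ^ k * m ^ k)⁻¹ * (δ / 8) := by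
    rw [neg_add, Real.exp_add, Real.exp_neg, Real.exp_neg, Real.exp_nat_mul,
      Real.exp_log (by positivity), Real.exp_log (by positivity), mul_pow, inv_div]
  have h2 : (13 * k : ℝ) ≤ 8 * 8 ^ k := by
    have h := one_add_mul_le_pow (a := (7 : ℝ)) (by norm_num) k
    norm_num at h
    have : (0 : ℝ) ≤ k := by positivity
    linarith
  rw [h1]
  calc 13 * k * (m : ℝ) ^ k * (((8 : ℝ) ^ k * m ^ k)⁻¹ * (δ / 8))
      = (13 * k) / (8 * 8 ^ k) * δ := by field_simp
    _ ≤ 1 * δ := by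
        gcongr
        rw [div_le_one (by positivity)]
        exact h2
    _ = δ := one_mul δ

end Numerics

variable {X : Type*} [MetricSpace X] [MeasurableSpace X]

/-- With probability at least `1 - δ`, SKM2 selects `k` centers, and its risk is at most twice that
of any fixed `k`-tuple of centers, up to additive terms. -/
lemma le_measureReal_skm2 (hd : Measurable fun p : X × X => dist p.1 p.2)
    (hb : ∀ x y : X, dist x y ≤ 1) {k m : ℕ} {δ : ℝ} (hk : 1 ≤ k) (hm : 2 ≤ m) (hδ : 0 < δ)
    (hδ1 : δ < 1)
    (hlarge : 1000 * ((k : ℝ) ^ 3 * Real.log m + (k : ℝ) ^ 2 * Real.log (1 / δ)) ≤ (m : ℝ))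
    (P : Measure X) [IsProbabilityMeasure P] (c : Fin k → X) :
    1 - δ ≤ (Measure.pi fun _ : Fin m => P).real {S | (skm2 k m δ S).card = k ∧
      risk P {t | t ∈ skm2 k m δ S} ≤ 2 * risk P (Set.range c)
        + 900 * (((k : ℝ) ^ 3 * Real.log m + (k : ℝ) ^ 2 * Real.log (1 / δ)) / m)
        + 20 * Real.sqrt (((k : ℝ) * Real.log m + Real.log (1 / δ)) / m)} := by
  have hk1 : (1 : ℝ) ≤ k := by exact_mod_cast hk
  have hM : (2 : ℝ) ≤ m := by exact_mod_cast hm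
  have hexp := mul_pow_mul_exp_le (k := k) (m := m) (by omega) hδ
  set K : ℝ := (k : ℝ)
  set M : ℝ := (m : ℝ)
  set l := Real.log M with hl
  set d := Real.log (1 / δ) with hd'
  set G := K * l + d with hG
  have hDG : K ^ 3 * l + K ^ 2 * d = K ^ 2 * G := by rw [hG]; ring
  rw [hDG] at hlarge ⊢
  set Λ := K * Real.log (8 * M) + Real.log (8 / δ) with hΛ
  have hlog2 : Real.log 2 ≤ l := Real.log_le_log (by norm_num) hM
  have hlog8 : Real.log 8 = 3 * Real.log 2 := by
    rw [show (8 : ℝ) = 2 ^ 3 by norm_num, Real.log_pow]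
    norm_num
  have hl2 : 0.69 < l := by linarith [Real.log_two_gt_d9]
  have hd0 : 0 < d := Real.log_pos (by rw [lt_div_iff₀ hδ]; linarith)
  have hlog8M : Real.log (8 * M) = Real.log 8 + l := Real.log_mul (by norm_num) (by linarith)
  have hlog8δ : Real.log (8 / δ) = Real.log 8 + d := by
    rw [hd', Real.log_div (by norm_num) hδ.ne', Real.log_div (by norm_num) hδ.ne', Real.log_one]
    ring
  -- From `log 8 = 3 log 2 ≤ 3 l` and `1 ≤ K`.
  have hΛG : Λ ≤ 7 * G := by
    rw [hΛ, hG, hlog8M, hlog8δ]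
    nlinarith
  have hΛ0 : 0 < Λ := by
    rw [hΛ, hlog8M, hlog8δ]
    have : 0 < Real.log 8 := by linarith [Real.log_two_gt_d9]
    nlinarith
  have hGK : 0.69 * K ≤ G := by
    rw [hG]
    nlinarith
  have hG0 : 0 < G := by linarith
  have hKGM : 1000 * (K * G) ≤ M := by
    have h : K * G ≤ K * (K * G) := le_mul_of_one_le_left (by positivity) hk1
    linarith [show K * (K * G) = K ^ 2 * G by ring]
  have hGM : 1000 * G ≤ M := by linarith [le_mul_of_one_le_left hG0.le hk1]
  have hm8 : 8 * k ≤ m := by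
    have : (8 : ℝ) * (k : ℝ) ≤ (m : ℝ) := by linarith
    exact_mod_cast this
  have hbs : M ≤ 8 * (K * blockSize k m) := by
    have : (m : ℝ) ≤ 8 * ((k : ℝ) * blockSize k m) :=
      by exact_mod_cast le_eight_mul_blockSize hk hm8
    exact this
  have hws : M ≤ 4 * (K * (m / 2 / k : ℕ)) := by
    have : (m : ℝ) ≤ 4 * ((k : ℝ) * (m / 2 / k : ℕ)) :=
      by exact_mod_cast le_four_mul_windowSize hk hm8
    exact this
  have hfs : M ≤ 8 * (m / 4 : ℕ) := by
    have h : m ≤ 8 * (m / 4) := by omega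
    have : (m : ℝ) ≤ 8 * (m / 4 : ℕ) := by exact_mod_cast h
    exact this
  have hM0 : 0 < M := by linarith
  have hqΛ : qParam k m δ = 32 * K * Λ / M := by
    rw [qParam, hΛ]
    ring
  set q := qParam k m δ with hq
  have hq0 : 0 < q := by rw [hqΛ]; positivity
  have hKΛ : K * Λ ≤ K * (7 * G) := mul_le_mul_of_nonneg_left hΛG (by linarith)
  have hΛM : 0 < Λ * M := mul_pos hΛ0 hM0
  have hq1 : 4 * q ≤ 1 := by
    rw [hqΛ, ← mul_div_assoc, div_le_one hM0]
    linarith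
  have hKq : K * (4 * q) ≤ 896 * (K ^ 2 * G / M) := by
    rw [hqΛ, ← mul_div_assoc, ← mul_div_assoc, ← mul_div_assoc]
    refine div_le_div_of_nonneg_right ?_ hM0.le
    linarith [mul_le_mul_of_nonneg_left hΛG (sq_nonneg K)]
  have hDM : 1000 * (K ^ 2 * G / M) ≤ 1 := by
    rw [← mul_div_assoc, div_le_one hM0]
    exact hlarge
  have hqb : 3 * Λ ≤ q * blockSize k m := by
    have : q * blockSize k m = 4 * Λ * (8 * (K * blockSize k m)) / M := by rw [hqΛ]; ring
    rw [this, le_div_iff₀ hM0]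
    linarith [mul_le_mul_of_nonneg_left hbs hΛ0.le]
  have hqL : 8 * Λ ≤ q * (m / 2 / k : ℕ) := by
    have : q * (m / 2 / k : ℕ) = 8 * Λ * (4 * (K * (m / 2 / k : ℕ))) / M := by rw [hqΛ]; ring
    rw [this, le_div_iff₀ hM0]
    linarith [mul_le_mul_of_nonneg_left hws hΛ0.le]
  -- Chosen so that `2 ε² |S₀| ≥ Λ`, given `|S₀| ≥ M / 8`.
  set ε := Real.sqrt (4 * Λ / M) with hε
  have hε0 : 0 ≤ ε := Real.sqrt_nonneg _
  have hεsq : ε ^ 2 = 4 * Λ / M := Real.sq_sqrt (by positivity)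
  have hεΛ : Λ ≤ 2 * ε ^ 2 * (m / 4 : ℕ) := by
    have : 2 * ε ^ 2 * (m / 4 : ℕ) = Λ * (8 * (m / 4 : ℕ)) / M := by rw [hεsq]; ring
    rw [this, le_div_iff₀ hM0]
    linarith [mul_le_mul_of_nonneg_left hfs hΛ0.le]
  set g := Real.sqrt (G / M) with hg
  have hg0 : 0 ≤ g := Real.sqrt_nonneg _
  have hgsq : g ^ 2 = G / M := Real.sq_sqrt (by positivity)
  have hεg : ε ≤ 6 * g := by
    refine Real.sqrt_le_iff.2 ⟨by positivity, ?_⟩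
    rw [mul_pow, hgsq, ← mul_div_assoc]
    exact div_le_div_of_nonneg_right (by linarith) hM0.le
  have hε1 : ε ≤ 1 := by
    refine Real.sqrt_le_iff.2 ⟨zero_le_one, ?_⟩
    rw [div_le_iff₀ hM0]
    linarith
  set β := 1 / Real.sqrt M with hβ
  have hβ0 : 0 ≤ β := by positivity
  have hβg : β ≤ 2 * g := by
    rw [hβ, hg, Real.sqrt_div hG0.le, ← mul_div_assoc]
    gcongr
    have : 1 / 2 ≤ Real.sqrt G := Real.le_sqrt_of_sq_le (by linarith)
    linarith
  obtain ⟨hO0, hO1⟩ := risk_range_mem_Icc P hd hb c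
  set R := 2 * risk P (Set.range c) + K * (4 * q) + ε with hRdef
  have hR4 : R ≤ 4 := by linarith
  have hR0 : 0 ≤ R := by positivity
  have hbpos : 0 < blockSize k m := by
    by_contra! h
    have h0 : (blockSize k m : ℝ) = 0 := by exact_mod_cast Nat.le_zero.1 h
    rw [h0] at hbs
    linarith
  have hfail := measureReal_skm2_fails_le P hd hb hk (by omega) hbpos c hq hq0 hq1 hε0 hR4 hqb
    hqL hεΛ hΛ0.le
  have hfail' := hfail.trans hexp
  rw [← hRdef] at hfail'
  set F := {S : Fin m → X | ¬ ((skm2 k m δ S).card = k ∧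
      risk P {t | t ∈ skm2 k m δ S} ≤ max β ((1 + β) * R) + ε)} with hF
  -- Subadditivity suffices, so measurability of `F` is not needed.
  have hone : (1 : ℝ) ≤ (Measure.pi fun _ : Fin m => P).real Fᶜ
      + (Measure.pi fun _ : Fin m => P).real F := by
    have h := measureReal_union_le (μ := Measure.pi fun _ : Fin m => P) Fᶜ F
    rwa [Set.compl_union_self, probReal_univ] at h
  have hmono : (Measure.pi fun _ : Fin m => P).real Fᶜ ≤
      (Measure.pi fun _ : Fin m => P).real {S | (skm2 k m δ S).card = k ∧
      risk P {t | t ∈ skm2 k m δ S} ≤ 2 * risk P (Set.range c)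
        + 900 * (K ^ 2 * G / M) + 20 * g} := by
    refine measureReal_mono fun S hS => ?_
    obtain ⟨h1, h2⟩ := not_not.1 hS
    refine ⟨h1, h2.trans ?_⟩
    -- The factor `20` below is `6 + 6` for the two occurrences of `ε` and `4 * 2` for `4 * β`; the
    -- factor `900` absorbs `896` from `hKq`.
    have hmax : max β ((1 + β) * R) ≤ R + 4 * β := max_le (by linarith)
      (by linarith [mul_le_mul_of_nonneg_left hR4 hβ0])
    have hDM0 : 0 ≤ K ^ 2 * G / M := by positivity
    linarith
  linarith

end NoSubstitution

/-! ### The theorem -/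

theorem theorem3 :
    ∃ C : ℝ, 0 < C ∧
      ∀ (X : Type*) [MetricSpace X] [MeasurableSpace X],
        Measurable (fun p : X × X => dist p.1 p.2) →
        (∀ x y : X, dist x y ≤ 1) →
        ∀ (k m : ℕ) (δ : ℝ), 1 ≤ k → 2 ≤ m → 0 < δ → δ < 1 →
        C * ((k : ℝ) ^ 3 * Real.log m + (k : ℝ) ^ 2 * Real.log (1 / δ)) ≤ (m : ℝ) →
        ∀ (P : MeasureTheory.Measure X) [MeasureTheory.IsProbabilityMeasure P]
          (OPT : Fin k → X), NoSubstitution.IsOptimal P OPT →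
          (∀ γ : ℝ, 0 < γ → γ < 1 / 2 →
            1 - δ ≤ (MeasureTheory.Measure.pi fun _ : Fin m => P).real
              {S | (NoSubstitution.skm2 k m δ S).card = k ∧
                NoSubstitution.risk P {t | t ∈ NoSubstitution.skm2 k m δ S} ≤
                  (2 + 2 * γ) * NoSubstitution.risk P (Set.range OPT)
                  + 1 / γ * (C * (((k : ℝ) ^ 3 * Real.log m
                      + (k : ℝ) ^ 2 * Real.log (1 / δ)) / (m : ℝ)))
                  + C * Real.sqrt (((k : ℝ) * Real.log m + Real.log (1 / δ)) / (m : ℝ))}) ∧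
          1 - δ ≤ (MeasureTheory.Measure.pi fun _ : Fin m => P).real
            {S | (NoSubstitution.skm2 k m δ S).card = k ∧
              NoSubstitution.risk P {t | t ∈ NoSubstitution.skm2 k m δ S} ≤
                2 * NoSubstitution.risk P (Set.range OPT)
                + C * Real.sqrt (((k : ℝ) ^ 3 * Real.log m
                    + (k : ℝ) ^ 2 * Real.log (1 / δ)) / (m : ℝ))} := by
  refine ⟨1000, by norm_num, ?_⟩
  intro X _ _ hd hb k m δ hk hm hδ hδ1 hlarge P _ OPT _
  have hmain := NoSubstitution.le_measureReal_skm2 hd hb hk hm hδ hδ1 hlarge P OPT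
  have hk1 : (1 : ℝ) ≤ k := by exact_mod_cast hk
  have hM : (2 : ℝ) ≤ m := by exact_mod_cast hm
  have hl : 0 ≤ Real.log m := Real.log_nonneg (by linarith)
  have hd0 : 0 ≤ Real.log (1 / δ) := Real.log_nonneg (by rw [le_div_iff₀ hδ]; linarith)
  have hO := (NoSubstitution.risk_range_mem_Icc P hd hb OPT).1
  set D := ((k : ℝ) ^ 3 * Real.log m + (k : ℝ) ^ 2 * Real.log (1 / δ)) / (m : ℝ) with hD
  have hD0 : 0 ≤ D := by positivity
  have hD1 : D ≤ 1 := by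
    rw [hD, div_le_one (by linarith)]
    have : 0 ≤ (k : ℝ) ^ 3 * Real.log m + (k : ℝ) ^ 2 * Real.log (1 / δ) := by positivity
    linarith
  have hGD : ((k : ℝ) * Real.log m + Real.log (1 / δ)) / (m : ℝ) ≤ D := by
    rw [hD]
    gcongr ?_ / _
    have hk2 : (1 : ℝ) ≤ (k : ℝ) ^ 2 := one_le_pow₀ hk1
    have h1 : (k : ℝ) * Real.log m ≤ (k : ℝ) ^ 3 * Real.log m := by
      gcongr
      nlinarith
    have h2 := mul_le_mul_of_nonneg_right hk2 hd0
    linarith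
  have hg0 := Real.sqrt_nonneg (((k : ℝ) * Real.log m + Real.log (1 / δ)) / (m : ℝ))
  have hsqrt := Real.sqrt_le_sqrt hGD
  have hDs : D ≤ Real.sqrt D := Real.le_sqrt_of_sq_le (by nlinarith)
  -- `hmain` already has leading factor `2` and an additive term linear in `D`. The first bound
  -- follows from `1 ≤ 1 / γ`, the second from `D ≤ √D`, valid as `D ≤ 1`.
  refine ⟨fun γ hγ hγ2 => hmain.trans (MeasureTheory.measureReal_mono fun S hS => ⟨hS.1, ?_⟩),
    hmain.trans (MeasureTheory.measureReal_mono fun S hS => ⟨hS.1, ?_⟩)⟩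
  · have hγ1 : 1 ≤ 1 / γ := by rw [le_div_iff₀ hγ]; linarith
    have h1 : 1 * (1000 * D) ≤ 1 / γ * (1000 * D) := by gcongr
    have h2 := mul_nonneg hγ.le hO
    linarith [hS.2]
  · linarith [hS.2]
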